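/- Let $r(x)=\sinh^{-1}(1/\sinh x)$ for $x>0$. Let $P$ be a geodesic pair of pants (boundary components are closed geodesics or punctures), $\alpha$ a boundary geodesic of $P$ of length $\ell(\alpha)$, and $\gamma$ the simple orthogeodesic from $\alpha$ to another boundary component $\alpha_1$. Let $b$ be the endpoint of $\gamma$ on $\alpha_1$; if $\alpha_1$ is a puncture, $b$ is that puncture and $\ell(\gamma)=\infty$. In each of the two right-angled hexagons (degenerate at the punctures) into which $P$ is cut by its three simple orthogeodesics between distinct boundary components, drop the perpendicular from $b$ to the simple orthogeodesic from $\alpha$ to the third boundary component $\alpha_2$. The two perpendiculars form a loop $\beta$. The annulus $R_{\alpha,\gamma}$ between $\alpha$ and $\beta$ is the nonstandard half-collar, and $\ell(\eta)$ denotes the length of the part $\eta$ of the orthogeodesic from $\alpha$ to $\alpha_2$ that lies between $\alpha$ and $\beta$. Let $R_{\alpha',\gamma'}$, with loop $\beta'$ and segment $\eta'$, be another nonstandard half-collar, with $\ell(\alpha')=\ell(\alpha)$. For $-\frac12\le t\le\frac12$ let $R^{t}_{\alpha,\gamma,\gamma'}$ be the annulus obtained by gluing the two half-collars isometrically along $\alpha\equiv\alpha'$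 with twist $t$, i.e. so that the foot of $\gamma'$ on $\alpha$ is obtained from the foot of $\gamma$ by moving the signed distance $t\,\ell(\alpha)$ along $\alpha$. Let $\lambda(R^{t}_{\alpha,\gamma,\gamma'})=1/\operatorname{mod}\Gamma$ be the extremal distance between its two boundary components, where $\Gamma$ is the family of curves in the annulus connecting these components and $\operatorname{mod}\Gamma=\inf_\rho\iint\rho^2\,dx\,dy$ over the nonnegative Borel metrics $\rho|dz|$ for which every curve of $\Gamma$ has length at least $1$. For every $\ell_0\ge 2$ there is a constant $C>0$, depending only on $\ell_0$, such that for all such half-collars with $\ell(\alpha)\ge\ell_0$ and all $t\in[-\frac12,\frac12]$, $$\lambda(R^{t}_{\alpha,\gamma,\gamma'})\ \ge\ \frac{C}{\max\left\{e^{\,r(\ell(\eta))-|t|\ell(\alpha)/2},\ e^{\,r(\ell(\eta'))-|t|\ell(\alpha)/2}\right\}} .$$ Moreover, with the same constant $C$, if $\ell(\gamma)=\ell(\gamma')=\infty$ (both orthogeodesics end at punctures), then $$\lambda(R^{t}_{\alpha,\gamma,\gamma'})\ \ge\ C\,e^{-(1-|t|)\ell(\alpha)/2}.$$ -/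

import Mathlib

open scoped UpperHalfPlane NNReal ENNReal MatrixGroups

noncomputable section

/-! ### Modulus and extremal distance in plane domains -/

/-- The `ρ`-length `∫_c ρ |dz|` of a locally rectifiable curve, given by a parametrization
on `[0,1]` that is locally Lipschitz in `(0,1)`. -/
def rhoLength (ρ : ℂ → ℝ≥0) (c : ℝ → ℂ) : ℝ≥0∞ :=
  ∫⁻ s in Set.Ioo (0 : ℝ) 1, (ρ (c s) : ℝ≥0∞) * ‖deriv c s‖ₑ

/-- The modulus, in the plane domain `Ω`, of a family `Γ` of curves: the infimum of
`∬_Ω ρ² dx dy` over all nonnegative Borel `ρ` such that every curve of `Γ` has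
`ρ`-length at least one. -/
def curveModulus (Ω : Set ℂ) (Γ : Set (ℝ → ℂ)) : ℝ≥0∞ :=
  ⨅ ρ : {ρ : ℂ → ℝ≥0 // Measurable ρ ∧ ∀ c ∈ Γ, 1 ≤ rhoLength ρ c},
    ∫⁻ z in Ω, (ρ.1 z : ℝ≥0∞) ^ 2

/-- The curves in `Ω` that connect `E` to `F`. Every locally rectifiable curve can be
parametrized (locally by arc length) by a map that is locally Lipschitz in `(0,1)`. -/
def connectingCurves (Ω E F : Set ℂ) : Set (ℝ → ℂ) :=
  {c | ContinuousOn c (Set.Icc 0 1) ∧ LocallyLipschitzOn (Set.Ioo (0 : ℝ) 1) c ∧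
    c 0 ∈ E ∧ c 1 ∈ F ∧ ∀ s ∈ Set.Ioo (0 : ℝ) 1, c s ∈ Ω}

/-- The extremal distance between `E` and `F` in `Ω`: the extremal length (the reciprocal of
the modulus) of the family of curves in `Ω` that connect `E` to `F`. -/
def extremalDistance (Ω E F : Set ℂ) : ℝ≥0∞ :=
  (curveModulus Ω (connectingCurves Ω E F))⁻¹

/-! ### Geodesics of the hyperbolic plane

An element `g` of `GL(2,ℝ)`, which acts on `ℍ` as an isometry (orientation reversing if
`det g < 0`), encodes the oriented geodesic which is the image under `g` of the positive
imaginary axis, together with the half-plane which is the image of `{Re z > 0}`. -/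

namespace Hyp

/-- The complete geodesic `g · {Re z = 0}`. -/
def line (g : GL (Fin 2) ℝ) : Set ℍ := {z | (g⁻¹ • z).re = 0}

/-- The open half-plane `g · {Re z > 0}`, bounded by the geodesic of `g`. -/
def side (g : GL (Fin 2) ℝ) : Set ℍ := {z | 0 < (g⁻¹ • z).re}

/-- The closed half-plane `g · {Re z ≥ 0}`. -/
def closedSide (g : GL (Fin 2) ℝ) : Set ℍ := {z | 0 ≤ (g⁻¹ • z).re}

/-- The two endpoints at infinity, in `ℝ ∪ {∞}`, of the geodesic of `g`. -/
def ends (g : GL (Fin 2) ℝ) : Set (OnePoint ℝ) :=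
  {g • ((0 : ℝ) : OnePoint ℝ), g • (OnePoint.infty : OnePoint ℝ)}

/-- The hyperbolic reflection in the geodesic of `g`
(`UpperHalfPlane.J` acts as `z ↦ -conj z`). -/
def reflection (g : GL (Fin 2) ℝ) : GL (Fin 2) ℝ := g * UpperHalfPlane.J * g⁻¹

/-- Two geodesics are orthogonal if an isometry carries the imaginary axis and the unit
semicircle to them. -/
def Orthogonal (g h : GL (Fin 2) ℝ) : Prop :=
  ∃ k : GL (Fin 2) ℝ, line g = line k ∧ line h = {z | ‖((k⁻¹ • z : ℍ) : ℂ)‖ = 1}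

end Hyp

open Hyp

/-- A geodesic pair of pants with a chosen boundary geodesic `α` and a chosen simple
orthogeodesic `γ` from `α` to another boundary component `α₁`.

A geodesic pair of pants is, in a unique way, the double of a right-angled hexagon along three
alternating sides, the seams, which are its simple orthogeodesics between different boundary
components. It is given here by a lift of one of the two hexagons to `ℍ`. The seams lie on three
geodesics that are pairwise disjoint, none of them separating the other two; each of them is
oriented so that the hexagon lies on its positive side. Two of the three geodesics either have a
common perpendicular, which is then the lift of a boundary geodesic, or they have a common
endpoint at infinity, which is then a puncture.
* `γ` carries the seam from `α` to `α₁`,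
* `ζ` carries the seam from `α` to the third boundary component `α₂`,
* `δ` carries the seam from `α₁` to `α₂`,
* `α` is the lift of the chosen boundary geodesic, with the hexagon on its positive side. -/
structure MarkedPants where
  γ : GL (Fin 2) ℝ
  ζ : GL (Fin 2) ℝ
  δ : GL (Fin 2) ℝ
  γ_ζ : line γ ⊆ side ζ
  γ_δ : line γ ⊆ side δ
  ζ_γ : line ζ ⊆ side γ
  ζ_δ : line ζ ⊆ side δ
  δ_γ : line δ ⊆ side γ
  δ_ζ : line δ ⊆ side ζ
  α : GL (Fin 2) ℝ
  α_orth_γ : Orthogonal α γ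
  α_orth_ζ : Orthogonal α ζ
  δ_α : line δ ⊆ side α

/-- The boundary component `α₁` at which `γ` ends is a puncture (so that `ℓ(γ) = ∞`). -/
def MarkedPants.IsCusped (P : MarkedPants) : Prop := (ends P.γ ∩ ends P.δ).Nonempty

/-- The nonstandard half-collar `R_{α,γ}`, presented by the geodesics and points that define it.
Let `b` be the endpoint of `γ` on `α₁` (a point of `ℍ`, or a point at infinity if `α₁` is a
puncture). The loop around the half-collar consists of the perpendicular from `b` to the
geodesic `ζ` and of its mirror image in the other hexagon. -/
structure NonstandardHalfCollar extends MarkedPants where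
  /-- the geodesic that carries the perpendicular from `b` to `ζ`, with `α` on its
  positive side -/
  β : GL (Fin 2) ℝ
  β_orth_ζ : Orthogonal β ζ
  α_β : line α ⊆ side β
  β_through_b :
    (∃ α₁ : GL (Fin 2) ℝ, Orthogonal α₁ γ ∧ Orthogonal α₁ δ ∧
      (line γ ∩ line α₁ ∩ line β).Nonempty) ∨
    (ends γ ∩ ends δ ∩ ends β).Nonempty
  /-- the foot on `α` of `γ` (the marked point) -/
  x : ℍ
  x_mem : x ∈ line α ∩ line γ
  /-- the foot on `α` of the other seam that starts at `α` -/
  y : ℍ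
  y_mem : y ∈ line α ∩ line ζ
  /-- the foot on `ζ` of the perpendicular from `b` -/
  c : ℍ
  c_mem : c ∈ line β ∩ line ζ

namespace NonstandardHalfCollar

variable (H : NonstandardHalfCollar)

/-- The length `ℓ(α)` of the boundary geodesic: `α` is made of two copies of the segment from
`x` to `y`, one in each hexagon. -/
def lengthAlpha : ℝ := 2 * dist H.x H.y

/-- The length `ℓ(η)` of the orthogonal `η` from `α` to the loop. -/
def lengthEta : ℝ := dist H.y H.c

/-- The part of the half-collar in the lifted hexagon: the quadrilateral bounded by `α`, `γ`,
the perpendicular from `b` to `ζ`, and `η`, with the perpendicular removed. -/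
def quadrilateral : Set ℍ :=
  closedSide H.α ∩ closedSide H.γ ∩ closedSide H.ζ ∩ side H.β

/-- The perpendicular from `b` to `ζ`, as a segment (a ray in the cusped case). -/
def perpendicular : Set ℍ := line H.β ∩ closedSide H.γ ∩ closedSide H.ζ

/-- The union of a subset of the lifted hexagon with its mirror image in the adjacent lift of
the other hexagon. -/
def double (S : Set ℍ) : Set ℍ := S ∪ (fun z : ℍ => reflection H.ζ • z) '' S

/-- The lift of the boundary geodesic `α` is the positive imaginary axis, and the half-collar is
on its left. -/
def PlacedLeft : Prop := line H.α = {z | z.re = 0} ∧ side H.α = {z | z.re < 0}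

/-- The lift of the boundary geodesic `α` is the positive imaginary axis, and the half-collar is
on its right. -/
def PlacedRight : Prop := line H.α = {z | z.re = 0} ∧ side H.α = {z | 0 < z.re}

end NonstandardHalfCollar

/-- The map `w ↦ exp((2πi/ℓ) log w)`. It is the universal covering from `ℍ` onto the round
annulus `{exp(-2π²/ℓ) < |z| < 1}`, with deck group generated by the hyperbolic translation
`w ↦ e^ℓ w` along the imaginary axis; it identifies the hyperbolic cylinder
`ℍ / ⟨w ↦ e^ℓ w⟩`, which has a core geodesic of length `ℓ`, conformally with that annulus. -/
def cylinderMap (l : ℝ) (w : ℍ) : ℂ :=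
  Complex.exp (2 * Real.pi * Complex.I / l * Complex.log (w : ℂ))

namespace NonstandardHalfCollar

variable (H : NonstandardHalfCollar)

/-- The half-collar `R_{α,γ}`, with its boundary geodesic `α` included, in the cylinder of core
length `ℓ(α)`: the two quadrilaterals meet along `η`, and the cylinder map glues their
remaining sides on the two lifts of `γ`. -/
def region : Set ℂ := cylinderMap H.lengthAlpha '' H.double H.quadrilateral

/-- The boundary component of the half-collar other than `α`: the geodesic loop, together with
the puncture in the cusped case. -/
def loop : Set ℂ := closure (cylinderMap H.lengthAlpha '' H.double H.perpendicular)

end NonstandardHalfCollar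

/-- `H` and `H'` are placed on the two sides of a common boundary geodesic `α` of length `ℓ(α)`,
such that the position of the marked point `x'` relative to `x`, along `α`, is
`t ℓ(α)` modulo `ℓ(α)`. -/
structure GluedWithTwist (H H' : NonstandardHalfCollar) (t : ℝ) : Prop where
  left : H.PlacedLeft
  right : H'.PlacedRight
  length_eq : H'.lengthAlpha = H.lengthAlpha
  twist : ∃ k : ℤ, H'.x.im = H.x.im * Real.exp ((t + k) * H.lengthAlpha)

/-- The extremal distance between the two boundary components of the annulus obtained by gluing
two half-collars along their boundary geodesics, that is, of their union in the cylinder. -/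
def gluedExtremalDistance (H H' : NonstandardHalfCollar) : ℝ≥0∞ :=
  extremalDistance (H.region ∪ H'.region) H.loop H'.loop

/-- `r(x) = arsinh (1 / sinh x)`. -/
def collarWidth (x : ℝ) : ℝ := Real.arsinh (1 / Real.sinh x)

end

/-! The proof exhibits one conformal density that is admissible for all connecting curves and
estimates its area.

Put `α` on the imaginary axis and describe a point `w` of `ℍ` by the signed angle `u` from `α` and
by `v = log ‖w‖ - log H.y.im`, the position along `α` relative to the foot of `η`. The perpendicular
`β` then has the equation `cosh s * sin u = cosh v`, with `s = collarWidth H.lengthEta`. Hence the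
half-collar has height comparable to `exp (|v| - s)` above the point `v`, where `|v| ≤ ℓ/2 ≤ s`. The
bound `ℓ/2 ≤ s` holds because `b` lies on `γ`, and it is an equality when `b` is a puncture
(`form_β`). With `κ = ℓ/(2π)`, the cylinder map turns `v` into an angle, `|v| = κ * angle z q`, and
`u` into `κ * log ‖z‖ + π/2` up to sign (`region_bound`, `loop_bound`).

The glued annulus thus has height comparable to `h = exp (|v| - s) + exp (|v'| - s')`, and in these
coordinates the density is a constant times `1/h`. Since `log h` is Lipschitz, `h` is nearly
constant on a disc of radius a small multiple of `h`. A curve that stayed in such a disc about its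
starting point could not climb from one loop to the other, so every connecting curve crosses the
disc and has length at least one (`one_le_rhoLength_collarDensity`).

The area is at most a constant times the integral of `1/h` along `α`, and `1/h` is at most both `exp
(s - |v|)` and `exp (s' - |v'|)`. The feet of `η` and `η'` are `|t|ℓ` apart, so each point of `α` is
at least `|t|ℓ/2` from one of them. The exponential tails therefore give area at most a constant
times `exp (max s s' - |t|ℓ/2)` (`curveModulus_connectingCurves_le`). The constant is absolute. In
the doubly cusped case `s = s' = ℓ/2`, which is the second claim. -/

open Hyp

/-! ### Lengths of curves -/

open MeasureTheory Set in
theorem enorm_sub_le_lintegral_enorm_deriv {c : ℝ → ℂ} {a b : ℝ} (hab : a ≤ b)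
    (hc : LocallyLipschitzOn (Icc a b) c) :
    ‖c b - c a‖ₑ ≤ ∫⁻ s in Ioo a b, ‖deriv c s‖ₑ := by
  obtain ⟨K, hK⟩ := hc.exists_lipschitzOnWith_of_compact isCompact_Icc
  -- Pairing with the unit vector along the chord reduces the claim to the fundamental theorem of
  -- calculus for a real Lipschitz function; `u = 0` covers a chord of length zero.
  obtain ⟨u, hu, huv⟩ : ∃ u : ℂ, ‖u‖ ≤ 1 ∧ inner ℝ u (c b - c a) = ‖c b - c a‖ := by
    by_cases h : c b - c a = 0
    · exact ⟨0, by simp, by simp [h]⟩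
    · refine ⟨(‖c b - c a‖⁻¹ : ℝ) • (c b - c a), ?_, ?_⟩
      · rw [norm_smul, norm_inv, norm_norm, inv_mul_cancel₀ (norm_ne_zero_iff.2 h)]
      · rw [real_inner_smul_left, real_inner_self_eq_norm_sq]
        field_simp [norm_ne_zero_iff.2 h]
  set f : ℝ → ℝ := fun s => innerSL ℝ u (c s) with hf
  have hflip : LipschitzOnWith (‖innerSL ℝ u‖₊ * K) f (uIcc a b) := by
    rw [uIcc_of_le hab]
    exact (innerSL ℝ u).lipschitz.comp_lipschitzOnWith hK
  have hint := hflip.absolutelyContinuousOnInterval.integral_deriv_eq_sub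
  have hfab : f b - f a = ‖c b - c a‖ := by
    rw [← huv, hf]; simp [inner_sub_right]
  rw [hfab] at hint
  have hdiff : ∀ᵐ s, s ∈ Ioo a b → ‖deriv f s‖ₑ ≤ ‖deriv c s‖ₑ := by
    filter_upwards [hK.ae_differentiableWithinAt_of_mem_real] with s hs hsab
    have hd : DifferentiableAt ℝ c s :=
      (hs (Ioo_subset_Icc_self hsab)).differentiableAt (Icc_mem_nhds hsab.1 hsab.2)
    have : HasDerivAt f (innerSL ℝ u (deriv c s)) s :=
      (innerSL ℝ u).hasFDerivAt.comp_hasDerivAt s hd.hasDerivAt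
    rw [this.deriv]
    rw [enorm_le_iff_norm_le]
    calc ‖innerSL ℝ u (deriv c s)‖ ≤ ‖u‖ * ‖deriv c s‖ := by
          simpa using norm_inner_le_norm (𝕜 := ℝ) u (deriv c s)
      _ ≤ 1 * ‖deriv c s‖ := by gcongr
      _ = _ := one_mul _
  calc ‖c b - c a‖ₑ = ‖∫ x in a..b, deriv f x‖ₑ := by rw [hint, enorm_norm]
    _ ≤ ∫⁻ s in Ioc a b, ‖deriv f s‖ₑ := by
        rw [intervalIntegral.integral_of_le hab]
        exact enorm_integral_le_lintegral_enorm _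
    _ = ∫⁻ s in Ioo a b, ‖deriv f s‖ₑ := by rw [restrict_Ioo_eq_restrict_Ioc]
    _ ≤ _ := lintegral_mono_ae ((ae_restrict_iff' measurableSet_Ioo).2 hdiff)

-- A connecting curve is only continuous at its endpoints, so the bound on interior subintervals is
-- carried to the endpoints by passing to the closure.
open MeasureTheory Set in
theorem enorm_sub_le_lintegral_enorm_deriv_of_continuousOn {c : ℝ → ℂ} {a b : ℝ} (hab : a < b)
    (hcont : ContinuousOn c (Icc a b)) (hc : LocallyLipschitzOn (Ioo a b) c) :
    ‖c b - c a‖ₑ ≤ ∫⁻ s in Ioo a b, ‖deriv c s‖ₑ := by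
  set L := ∫⁻ s in Ioo a b, ‖deriv c s‖ₑ with hL
  have key : ∀ p ∈ Ioo a b ×ˢ Ioo a b, ‖c p.2 - c p.1‖ₑ ≤ L := by
    have aux : ∀ x ∈ Ioo a b, ∀ y ∈ Ioo a b, x ≤ y → ‖c y - c x‖ₑ ≤ L := by
      intro x hx y hy hxy
      refine (enorm_sub_le_lintegral_enorm_deriv hxy
        (hc.mono (Icc_subset_Ioo hx.1 hy.2))).trans ?_
      exact lintegral_mono_set (Ioo_subset_Ioo hx.1.le hy.2.le)
    rintro ⟨x, y⟩ ⟨hx, hy⟩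
    rcases le_total x y with h | h
    · exact aux x hx y hy h
    · rw [← enorm_neg, neg_sub]; exact aux y hy x hx h
  have hcl : closure (Ioo a b ×ˢ Ioo a b) = Icc a b ×ˢ Icc a b := by
    rw [closure_prod_eq, closure_Ioo hab.ne]
  have hg : ContinuousOn (fun p : ℝ × ℝ => ‖c p.2 - c p.1‖ₑ)
      (closure (Ioo a b ×ˢ Ioo a b)) := by
    rw [hcl]
    refine continuous_enorm.comp_continuousOn (ContinuousOn.sub ?_ ?_)
    · exact hcont.comp continuousOn_snd (fun p hp => hp.2)
    · exact hcont.comp continuousOn_fst (fun p hp => hp.1)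
  have := le_on_closure key hg continuousOn_const (x := (a, b))
    (by rw [hcl]; exact ⟨left_mem_Icc.2 hab.le, right_mem_Icc.2 hab.le⟩)
  exact this

open MeasureTheory Set in
/-- A curve that leaves a disc about its starting point, on which the density is at least `m`,
has length at least `m` times the radius. -/
theorem mul_le_rhoLength_of_le_on_ball {ρ : ℂ → ℝ≥0} {c : ℝ → ℂ} {r : ℝ} {m : ℝ≥0}
    (hr : 0 < r) (hcont : ContinuousOn c (Icc 0 1)) (hc : LocallyLipschitzOn (Ioo (0 : ℝ) 1) c)
    (hend : r ≤ ‖c 1 - c 0‖) (hm : ∀ z, ‖z - c 0‖ < r → m ≤ ρ z) :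
    m * ENNReal.ofReal r ≤ rhoLength ρ c := by
  set S : Set ℝ := {s ∈ Icc (0 : ℝ) 1 | r ≤ ‖c s - c 0‖} with hS
  have hSclosed : IsClosed S :=
    isClosed_Icc.isClosed_le continuousOn_const (by fun_prop)
  have hSne : S.Nonempty := ⟨1, by simp, hend⟩
  have hSbdd : BddBelow S := ⟨0, fun s hs => hs.1.1⟩
  -- The first exit time: up to `τ` the curve runs inside the disc, where the density is at least
  -- `m`.
  set τ := sInf S with hτdef
  have hτ : τ ∈ S := hSclosed.csInf_mem hSne hSbdd
  have hτ0 : 0 < τ := by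
    rcases hτ.1.1.eq_or_lt with h | h
    · have := hτ.2
      rw [← h] at this
      simp at this
      linarith
    · exact h
  have hlt : ∀ s ∈ Ioo 0 τ, m ≤ ρ (c s) := by
    intro s hs
    refine hm _ (lt_of_not_ge fun h => ?_)
    have : τ ≤ s := csInf_le hSbdd ⟨⟨hs.1.le, hs.2.le.trans hτ.1.2⟩, h⟩
    exact absurd hs.2 (not_lt.2 this)
  have hlen := enorm_sub_le_lintegral_enorm_deriv_of_continuousOn hτ0
    (hcont.mono (Icc_subset_Icc_right hτ.1.2)) (hc.mono (Ioo_subset_Ioo_right hτ.1.2))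
  calc (m : ℝ≥0∞) * ENNReal.ofReal r ≤ m * ‖c τ - c 0‖ₑ := by
        gcongr
        rw [← ofReal_norm]
        exact ENNReal.ofReal_le_ofReal hτ.2
    _ ≤ m * ∫⁻ s in Ioo 0 τ, ‖deriv c s‖ₑ := by gcongr
    _ = ∫⁻ s in Ioo 0 τ, m * ‖deriv c s‖ₑ :=
        (lintegral_const_mul' _ _ ENNReal.coe_ne_top).symm
    _ ≤ ∫⁻ s in Ioo 0 τ, (ρ (c s) : ℝ≥0∞) * ‖deriv c s‖ₑ := by
        refine setLIntegral_mono' measurableSet_Ioo fun s hs => ?_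
        gcongr
        exact_mod_cast hlt s hs
    _ ≤ rhoLength ρ c := lintegral_mono_set (Ioo_subset_Ioo_right hτ.1.2)

open MeasureTheory in
theorem curveModulus_le {Ω : Set ℂ} {Γ : Set (ℝ → ℂ)} {ρ : ℂ → ℝ≥0} (hρ : Measurable ρ)
    (hadm : ∀ c ∈ Γ, 1 ≤ rhoLength ρ c) :
    curveModulus Ω Γ ≤ ∫⁻ z in Ω, (ρ z : ℝ≥0∞) ^ 2 :=
  iInf_le (fun ρ : {ρ : ℂ → ℝ≥0 // Measurable ρ ∧ ∀ c ∈ Γ, 1 ≤ rhoLength ρ c} =>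
    ∫⁻ z in Ω, (ρ.1 z : ℝ≥0∞) ^ 2) ⟨ρ, hρ, hadm⟩

/-! ### The density and its admissibility -/

open InnerProductGeometry in
theorem measurable_angle_left (q : ℂ) : Measurable fun z : ℂ => angle z q := by
  unfold angle; fun_prop

-- Projecting both points to the unit circle at most doubles the relative distance, and on the
-- circle an angle is at most `π/2` times its chord.
open InnerProductGeometry in
theorem angle_le_pi_mul_norm_sub_div {z w : ℂ} (hz : z ≠ 0) (hw : w ≠ 0) :
    angle z w ≤ Real.pi * (‖z - w‖ / ‖w‖) := by
  have hz' : 0 < ‖z‖ := norm_pos_iff.2 hz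
  have hw' : 0 < ‖w‖ := norm_pos_iff.2 hw
  have h1 : angle z w = angle ((‖z‖⁻¹ : ℝ) • z) ((‖w‖⁻¹ : ℝ) • w) := by
    rw [angle_smul_left_of_pos _ _ (inv_pos.2 hz'), angle_smul_right_of_pos _ _ (inv_pos.2 hw')]
  have n1 : ‖(‖z‖⁻¹ : ℝ) • z‖ = 1 := by rw [norm_smul, norm_inv, norm_norm, inv_mul_cancel₀ hz'.ne']
  have n2 : ‖(‖w‖⁻¹ : ℝ) • w‖ = 1 := by rw [norm_smul, norm_inv, norm_norm, inv_mul_cancel₀ hw'.ne']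
  have h2 : ‖(‖z‖⁻¹ : ℝ) • z - (‖w‖⁻¹ : ℝ) • w‖ ≤ 2 * (‖z - w‖ / ‖w‖) := by
    have e : (‖z‖⁻¹ : ℝ) • z - (‖w‖⁻¹ : ℝ) • w
        = (‖w‖⁻¹ : ℝ) • (z - w) + ((‖w‖ - ‖z‖) / ‖w‖ : ℝ) • ((‖z‖⁻¹ : ℝ) • z) := by
      rw [smul_sub, smul_smul]
      have : (‖w‖ - ‖z‖) / ‖w‖ * ‖z‖⁻¹ = ‖z‖⁻¹ - ‖w‖⁻¹ := by field_simp
      rw [this, sub_smul]; abel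
    rw [e]
    refine (norm_add_le _ _).trans ?_
    rw [norm_smul, norm_smul _ (_ • z), n1, norm_inv, norm_norm, norm_div, norm_norm,
      Real.norm_eq_abs]
    have : |‖w‖ - ‖z‖| ≤ ‖z - w‖ := by
      rw [norm_sub_rev z w]; exact abs_norm_sub_norm_le w z
    have : |‖w‖ - ‖z‖| / ‖w‖ ≤ ‖z - w‖ / ‖w‖ := by gcongr
    calc _ ≤ ‖w‖⁻¹ * ‖z - w‖ + ‖z - w‖ / ‖w‖ := by linarith
      _ = _ := by ring
  rw [h1]
  refine (Complex.angle_le_mul_norm_sub n1 n2).trans ?_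
  calc _ ≤ Real.pi / 2 * (2 * (‖z - w‖ / ‖w‖)) := by gcongr
    _ = _ := by ring

/-- In logarithmic coordinates on the annulus, a function comparable to the height of the glued
half-collars above the direction of `z`. -/
noncomputable def collarHeight (κ s s' : ℝ) (q q' z : ℂ) : ℝ :=
  Real.exp (κ * InnerProductGeometry.angle z q - s)
    + Real.exp (κ * InnerProductGeometry.angle z q' - s')

/-- The conformal density used to bound the modulus of the glued half-collars. -/
noncomputable def collarDensity (κ s s' : ℝ) (q q' z : ℂ) : ℝ :=
  12 * Real.pi * κ / (‖z‖ * collarHeight κ s s' q q' z)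

section
variable {κ s s' : ℝ} {q q' : ℂ}

theorem collarHeight_pos (z : ℂ) : 0 < collarHeight κ s s' q q' z := by
  unfold collarHeight; positivity

theorem measurable_collarHeight : Measurable (collarHeight κ s s' q q') := by
  unfold collarHeight
  have := measurable_angle_left q
  have := measurable_angle_left q'
  fun_prop

theorem measurable_collarDensity : Measurable (collarDensity κ s s' q q') := by
  unfold collarDensity
  have := @measurable_collarHeight κ s s' q q'
  fun_prop

theorem collarDensity_nonneg (hκ : 0 < κ) (z : ℂ) : 0 ≤ collarDensity κ s s' q q' z := by
  have := @collarHeight_pos κ s s' q q' z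
  unfold collarDensity; positivity

/-- The hypotheses say that half the core length is at most `s` and `s'`. The bound keeps the disc
used for admissibility away from the origin. -/
theorem collarHeight_le_two (hκ : 0 ≤ κ) (hs : κ * Real.pi ≤ s) (hs' : κ * Real.pi ≤ s') (z : ℂ) :
    collarHeight κ s s' q q' z ≤ 2 := by
  have h : ∀ (p : ℂ) (a : ℝ), κ * Real.pi ≤ a →
      Real.exp (κ * InnerProductGeometry.angle z p - a) ≤ 1 := by
    intro p a ha
    rw [Real.exp_le_one_iff]
    have := mul_le_mul_of_nonneg_left (InnerProductGeometry.angle_le_pi z p) hκ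
    linarith
  have h1 := h q s hs
  have h2 := h q' s' hs'
  unfold collarHeight; linarith

open InnerProductGeometry in
theorem exp_angle_le_mul_exp_angle (hκ : 0 ≤ κ) (z w p : ℂ) (a : ℝ) :
    Real.exp (κ * angle z p - a) ≤ Real.exp (κ * angle z w) * Real.exp (κ * angle w p - a) := by
  rw [← Real.exp_add, Real.exp_le_exp]
  have := mul_le_mul_of_nonneg_left (angle_le_angle_add_angle z w p) hκ
  linarith

-- The logarithm of the height is 1-Lipschitz in the arc length `κ * angle`, by the triangle
-- inequality for angles.
open InnerProductGeometry in
theorem collarHeight_le_mul (hκ : 0 ≤ κ) (z w : ℂ) :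
    collarHeight κ s s' q q' z ≤ Real.exp (κ * angle z w) * collarHeight κ s s' q q' w := by
  have h1 := exp_angle_le_mul_exp_angle hκ z w q s
  have h2 := exp_angle_le_mul_exp_angle hκ z w q' s'
  unfold collarHeight; linarith

theorem exp_half_le_two : Real.exp (1 / 2) ≤ 2 := by
  have h : Real.exp (1 / 2) ^ 2 = Real.exp 1 := by rw [← Real.exp_nat_mul]; norm_num
  nlinarith [Real.exp_one_lt_d9, Real.exp_pos (1 / 2)]

open InnerProductGeometry Set in
/-- The density `collarDensity` is admissible for curves that join sets which lie above and
below the core by at least a quarter of the height. -/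
theorem one_le_rhoLength_collarDensity (hκ : 1 ≤ Real.pi * κ) (hs : κ * Real.pi ≤ s)
    (hs' : κ * Real.pi ≤ s') {c : ℝ → ℂ}
    (hcont : ContinuousOn c (Icc 0 1)) (hc : LocallyLipschitzOn (Ioo (0 : ℝ) 1) c)
    (h0 : c 0 ≠ 0) (h1 : c 1 ≠ 0)
    (hE : Real.exp (κ * angle (c 0) q - s) / 2 ≤ -(κ * Real.log ‖c 0‖) - Real.pi / 2)
    (hE' : Real.exp (κ * angle (c 1) q' - s') / 2 ≤ κ * Real.log ‖c 1‖ + Real.pi / 2) :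
    1 ≤ rhoLength (fun z => (collarDensity κ s s' q q' z).toNNReal) c := by
  have hπ := Real.pi_pos
  have hκ0 : 0 < κ := by by_contra h; nlinarith
  set h := collarHeight κ s s' q q' (c 0) with hh
  have hpos : 0 < h := collarHeight_pos _
  have hle : h ≤ 2 := collarHeight_le_two hκ0.le hs hs' _
  have hn0 : 0 < ‖c 0‖ := norm_pos_iff.2 h0
  -- In logarithmic coordinates scaled by `κ`, this is a disc of radius `h / (4π)`: there the height
  -- changes by at most a factor 2, and the radius is less than the climb `h / 4` found below.
  set r := h / (4 * Real.pi * κ) * ‖c 0‖ with hrdef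
  have hr : 0 < r := by positivity
  have hε : h / (4 * Real.pi * κ) ≤ 1 / 2 := by
    rw [div_le_iff₀ (by positivity)]; nlinarith
  have near : ∀ z, ‖z - c 0‖ < r → z ≠ 0 ∧ κ * angle z (c 0) ≤ 1 / 2 ∧ ‖z‖ ≤ 3 / 2 * ‖c 0‖ := by
    intro z hz
    have hr2 : r ≤ 1 / 2 * ‖c 0‖ := by rw [hrdef]; gcongr
    have hz0 : z ≠ 0 := by
      rintro rfl
      rw [zero_sub, norm_neg] at hz; linarith
    refine ⟨hz0, ?_, ?_⟩
    · have hq : ‖z - c 0‖ / ‖c 0‖ ≤ h / (4 * Real.pi * κ) := by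
        rw [div_le_iff₀ hn0]; exact hz.le
      calc κ * angle z (c 0) ≤ κ * (Real.pi * (‖z - c 0‖ / ‖c 0‖)) := by
            gcongr; exact angle_le_pi_mul_norm_sub_div hz0 h0
        _ ≤ κ * (Real.pi * (h / (4 * Real.pi * κ))) := by gcongr
        _ = h / 4 := by field_simp
        _ ≤ 1 / 2 := by linarith
    · have : ‖z‖ ≤ ‖c 0‖ + ‖z - c 0‖ := by
        simpa using norm_add_le (c 0) (z - c 0)
      linarith
  have hend : r ≤ ‖c 1 - c 0‖ := by
    by_contra! hlt
    obtain ⟨-, hang, -⟩ := near _ hlt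
    have e1 := exp_angle_le_mul_exp_angle hκ0.le (c 0) (c 1) q' s'
    rw [angle_comm (c 0) (c 1)] at e1
    have e2 : Real.exp (κ * angle (c 1) (c 0)) ≤ 2 :=
      (Real.exp_le_exp.2 hang).trans exp_half_le_two
    have e3 : Real.exp (κ * angle (c 0) q' - s') ≤ 2 * Real.exp (κ * angle (c 1) q' - s') :=
      e1.trans (by gcongr)
    -- The two ends supply half of each summand of the height, but the second is evaluated at `c 1`;
    -- moving it to `c 0` costs another factor 2.
    have e4 : h / 4 ≤ κ * (Real.log ‖c 1‖ - Real.log ‖c 0‖) := by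
      have : h = Real.exp (κ * angle (c 0) q - s) + Real.exp (κ * angle (c 0) q' - s') := rfl
      have := Real.exp_pos (κ * angle (c 0) q - s)
      linarith
    have e5 : Real.log ‖c 1‖ - Real.log ‖c 0‖ ≤ h / (4 * Real.pi * κ) := by
      rw [← Real.log_div (norm_ne_zero_iff.2 h1) hn0.ne']
      refine (Real.log_le_sub_one_of_pos (div_pos (norm_pos_iff.2 h1) hn0)).trans ?_
      rw [div_sub_one hn0.ne', div_le_iff₀ hn0]
      have := norm_sub_norm_le (c 1) (c 0)
      linarith
    have e6 : κ * (h / (4 * Real.pi * κ)) = h / 4 / Real.pi := by field_simp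
    have e7 : κ * (Real.log ‖c 1‖ - Real.log ‖c 0‖) ≤ κ * (h / (4 * Real.pi * κ)) := by gcongr
    have e8 : h / 4 / Real.pi < h / 4 :=
      div_lt_self (by positivity) (by linarith [Real.pi_gt_three])
    linarith
  -- On the disc the modulus is at most `3/2 * ‖c 0‖` and the height at most `2 * h`. The factor 12
  -- in the density makes `m * r = 1`.
  set m := 12 * Real.pi * κ / (3 / 2 * ‖c 0‖ * (2 * h)) with hm
  have hm0 : 0 < m := by positivity
  have hball : ∀ z, ‖z - c 0‖ < r → m.toNNReal ≤ (collarDensity κ s s' q q' z).toNNReal := by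
    intro z hz
    obtain ⟨hz0, hang, hnorm⟩ := near z hz
    have := norm_pos_iff.2 hz0
    have hp := @collarHeight_pos κ s s' q q' z
    refine Real.toNNReal_le_toNNReal ?_
    unfold collarDensity
    rw [hm]
    have : collarHeight κ s s' q q' z ≤ 2 * h :=
      (collarHeight_le_mul hκ0.le z (c 0)).trans <| by
        gcongr
        exact (Real.exp_le_exp.2 hang).trans exp_half_le_two
    gcongr
  refine le_trans ?_ (mul_le_rhoLength_of_le_on_ball hr hcont hc hend hball)
  have : (m.toNNReal : ℝ≥0∞) = ENNReal.ofReal m := rfl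
  rw [this, ← ENNReal.ofReal_mul hm0.le]
  have : m * r = 1 := by rw [hm, hrdef]; field_simp; norm_num
  rw [this, ENNReal.ofReal_one]

end

/-! ### The area of the density -/

open MeasureTheory Set in
theorem setLIntegral_inv_Icc_exp {m w : ℝ} (hw : 0 ≤ w) :
    ∫⁻ r in Icc (Real.exp (m - w)) (Real.exp (m + w)), ENNReal.ofReal r⁻¹
      = ENNReal.ofReal (2 * w) := by
  have hle : Real.exp (m - w) ≤ Real.exp (m + w) := Real.exp_le_exp.2 (by linarith)
  have hp := Real.exp_pos (m - w)
  have hint : IntegrableOn (fun r : ℝ => r⁻¹) (Icc (Real.exp (m - w)) (Real.exp (m + w))) :=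
    (continuousOn_inv₀.mono fun x hx => ne_of_gt (hp.trans_le hx.1)).integrableOn_Icc
  rw [← ofReal_integral_eq_lintegral_ofReal hint]
  · rw [integral_Icc_eq_integral_Ioc, ← intervalIntegral.integral_of_le hle,
      integral_inv_of_pos hp (Real.exp_pos _), ← Real.exp_sub, Real.log_exp]
    ring_nf
  · refine (ae_restrict_iff' measurableSet_Icc).2 (ae_of_all _ fun r hr => ?_)
    exact inv_nonneg.2 (hp.le.trans hr.1)

open MeasureTheory Set in
theorem setLIntegral_exp_neg_abs_le {κ a : ℝ} (hκ : 0 < κ) (ha : 0 ≤ a) :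
    ∫⁻ x in {x : ℝ | a ≤ |x|}, ENNReal.ofReal (Real.exp (-(κ * |x|)))
      ≤ ENNReal.ofReal (2 * Real.exp (-(κ * a)) / κ) := by
  have hsub : {x : ℝ | a ≤ |x|} ⊆ Iic (-a) ∪ Ici a := by
    intro x hx
    rcases le_abs.1 (show a ≤ |x| from hx) with h | h
    · exact Or.inr h
    · exact Or.inl (by simp only [mem_Iic]; linarith)
  have h1 : ∫⁻ x in Iic (-a), ENNReal.ofReal (Real.exp (-(κ * |x|)))
      = ENNReal.ofReal (Real.exp (-(κ * a)) / κ) := by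
    rw [setLIntegral_congr_fun (g := fun x => ENNReal.ofReal (Real.exp (κ * x))) measurableSet_Iic,
      ← ofReal_integral_eq_lintegral_ofReal (integrableOn_exp_mul_Iic hκ _),
      integral_exp_mul_Iic hκ]
    · ring_nf
    · exact ae_of_all _ fun x => (Real.exp_pos _).le
    · intro x hx
      have : x ≤ 0 := by simp only [mem_Iic] at hx; linarith
      simp only [abs_of_nonpos this]; ring_nf
  have h2 : ∫⁻ x in Ici a, ENNReal.ofReal (Real.exp (-(κ * |x|)))
      = ENNReal.ofReal (Real.exp (-(κ * a)) / κ) := by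
    rw [setLIntegral_congr_fun (g := fun x => ENNReal.ofReal (Real.exp (-κ * x))) measurableSet_Ici,
      setLIntegral_congr Ioi_ae_eq_Ici.symm,
      ← ofReal_integral_eq_lintegral_ofReal (integrableOn_exp_mul_Ioi (neg_lt_zero.2 hκ) _),
      integral_exp_mul_Ioi (neg_lt_zero.2 hκ)]
    · congr 1; field_simp
    · exact ae_of_all _ fun x => (Real.exp_pos _).le
    · intro x hx
      have : 0 ≤ x := ha.trans hx
      simp only [abs_of_nonneg this]; ring_nf
  refine (lintegral_mono_set hsub).trans ((lintegral_union_le _ _ _).trans ?_)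
  rw [h1, h2, ← ENNReal.ofReal_add (by positivity) (by positivity)]
  ring_nf; rfl

theorem collarHeight_mul_of_pos {κ s s' r : ℝ} {q q' z : ℂ} (hr : 0 < r) :
    collarHeight κ s s' q q' (r * z) = collarHeight κ s s' q q' z := by
  unfold collarHeight
  rw [← Complex.real_smul, InnerProductGeometry.angle_smul_left_of_pos _ _ hr,
    InnerProductGeometry.angle_smul_left_of_pos _ _ hr]

theorem collarHeight_swap {κ s s' : ℝ} {q q' z : ℂ} :
    collarHeight κ s' s q' q z = collarHeight κ s s' q q' z := by
  unfold collarHeight; ring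

-- Polar coordinates measured from the direction `q`, so that the angle to `q` becomes `|θ|`.
open MeasureTheory in
theorem lintegral_rotate_polar (f : ℂ → ℝ≥0∞) (hf : Measurable f) {q : ℂ} (hq : ‖q‖ = 1) :
    ∫⁻ z, f z = ∫⁻ θ in Set.Ioo (-Real.pi) Real.pi, ∫⁻ r in Set.Ioi (0 : ℝ),
      ENNReal.ofReal r * f (r * (q * Complex.exp (θ * Complex.I))) := by
  have hrot : MeasurePreserving (fun z : ℂ => q * z) volume volume :=
    (rotation ⟨q, mem_sphere_zero_iff_norm.2 hq⟩).measurePreserving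
  have e : ∀ p : ℝ × ℝ, q * Complex.polarCoord.symm p
      = p.1 * (q * Complex.exp (p.2 * Complex.I)) := by
    intro p
    rw [Complex.polarCoord_symm_apply, Complex.exp_mul_I]; push_cast; ring
  rw [← hrot.lintegral_comp hf, ← Complex.lintegral_comp_polarCoord_symm, polarCoord_target,
    Measure.volume_eq_prod, ← Measure.prod_restrict]
  simp_rw [e, smul_eq_mul]
  rw [lintegral_prod_symm' _ (by fun_prop)]

-- On each ray the region fills a logarithmic interval of length at most `2πh/κ`, and `ρ² r =
-- (12πκ/h)² / r`. The radial integral is therefore at most a multiple of `κ/h ≤ κ * exp (s -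
-- κ|θ|)`, whose tail `|θ| ≥ a` is then integrated. Only the summand of `h` at `q` is used here; the
-- sector near `q` is left to `q'`.
open MeasureTheory Set InnerProductGeometry in
theorem setLIntegral_collarDensity_sq_sector_le {κ s s' a : ℝ} {q q' : ℂ} (hκ : 0 < κ)
    (hq : ‖q‖ = 1) (ha : 0 ≤ a) :
    ∫⁻ z in {z | |κ * Real.log ‖z‖ + Real.pi / 2| ≤ Real.pi * collarHeight κ s s' q q' z
        ∧ a ≤ angle z q}, ENNReal.ofReal (collarDensity κ s s' q q' z) ^ 2
      ≤ ENNReal.ofReal (4 * Real.pi * (12 * Real.pi) ^ 2 * Real.exp (s - κ * a)) := by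
  have hπ := Real.pi_pos
  have hHm := @measurable_collarHeight κ s s' q q'
  have hDm := @measurable_collarDensity κ s s' q q'
  have hAm := measurable_angle_left q
  set V := {z | |κ * Real.log ‖z‖ + Real.pi / 2| ≤ Real.pi * collarHeight κ s s' q q' z
        ∧ a ≤ angle z q} with hV
  have hVm : MeasurableSet V := by
    have hlog : Measurable fun z : ℂ => Real.log ‖z‖ := Real.measurable_log.comp measurable_norm
    have h1 : Measurable fun z : ℂ => |κ * Real.log ‖z‖ + Real.pi / 2| :=
      (continuous_abs (G := ℝ)).measurable.comp (by fun_prop)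
    exact (measurableSet_le h1 (hHm.const_mul _)).inter (measurableSet_le measurable_const hAm)
  rw [← lintegral_indicator hVm, lintegral_rotate_polar _ (by
    exact (((ENNReal.measurable_ofReal.comp hDm).pow_const 2).indicator hVm)) hq]
  have hq0 : q ≠ 0 := by rintro rfl; simp at hq
  have inner_le : ∀ θ ∈ Ioo (-Real.pi) Real.pi,
      ∫⁻ r in Ioi (0 : ℝ), ENNReal.ofReal r * V.indicator
        (fun z => ENNReal.ofReal (collarDensity κ s s' q q' z) ^ 2)
          (r * (q * Complex.exp (θ * Complex.I)))
      ≤ ENNReal.ofReal (2 * Real.pi * (12 * Real.pi) ^ 2 * κ * Real.exp s) *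
        {x : ℝ | a ≤ |x|}.indicator (fun x => ENNReal.ofReal (Real.exp (-(κ * |x|)))) θ := by
    intro θ hθ
    set w := q * Complex.exp (θ * Complex.I) with hw
    have hwn : ‖w‖ = 1 := by rw [hw, norm_mul, hq, Complex.norm_exp_ofReal_mul_I, one_mul]
    have hang : angle w q = |θ| := by
      have : angle w q = angle (q * Complex.exp (θ * Complex.I)) (q * 1) := by rw [mul_one]
      rw [this, Complex.angle_mul_left hq0, Complex.angle_exp_one,
        (toIocMod_eq_self Real.two_pi_pos).2]
      exact ⟨hθ.1, by linarith [hθ.2]⟩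
    set h := collarHeight κ s s' q q' w with hh
    have hpos : 0 < h := collarHeight_pos _
    have hlow : Real.exp (κ * |θ| - s) ≤ h := by
      rw [hh]; unfold collarHeight; rw [hang]
      linarith [Real.exp_pos (κ * angle w q' - s')]
    by_cases hθa : a ≤ |θ|
    · rw [indicator_of_mem (show θ ∈ {x : ℝ | a ≤ |x|} from hθa)]
      set I := Icc (Real.exp (-(Real.pi / 2 / κ) - Real.pi * h / κ))
        (Real.exp (-(Real.pi / 2 / κ) + Real.pi * h / κ)) with hI
      have pt : ∀ r ∈ Ioi (0 : ℝ), ENNReal.ofReal r * V.indicator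
          (fun z => ENNReal.ofReal (collarDensity κ s s' q q' z) ^ 2) (r * w)
          ≤ I.indicator (fun r => ENNReal.ofReal ((12 * Real.pi * κ / h) ^ 2)
            * ENNReal.ofReal r⁻¹) r := by
        intro r hr
        have hr0 : 0 < r := hr
        by_cases hmem : (r : ℂ) * w ∈ V
        · have hnorm : ‖(r : ℂ) * w‖ = r := by
            rw [norm_mul, hwn, mul_one, Complex.norm_real, Real.norm_of_nonneg hr0.le]
          have hrI : r ∈ I := by
            have h1 := hmem.1
            rw [hnorm, collarHeight_mul_of_pos hr0, ← hh, abs_le] at h1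
            obtain ⟨h1, h2⟩ := h1
            constructor
            · rw [← Real.le_log_iff_exp_le hr0]
              have : (-(Real.pi / 2 / κ) - Real.pi * h / κ)
                = (-(Real.pi * h) - Real.pi / 2) / κ := by ring
              rw [this, div_le_iff₀ hκ]; linarith
            · rw [← Real.log_le_iff_le_exp hr0]
              have : (-(Real.pi / 2 / κ) + Real.pi * h / κ)
                = ((Real.pi * h) - Real.pi / 2) / κ := by ring
              rw [this, le_div_iff₀ hκ]; linarith
          rw [indicator_of_mem hmem, indicator_of_mem hrI,
            ← ENNReal.ofReal_pow (collarDensity_nonneg hκ _), ← ENNReal.ofReal_mul hr0.le,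
            ← ENNReal.ofReal_mul (by positivity)]
          refine ENNReal.ofReal_le_ofReal (le_of_eq ?_)
          unfold collarDensity
          rw [hnorm, collarHeight_mul_of_pos hr0, ← hh]
          field_simp
        · rw [indicator_of_notMem hmem, mul_zero]; exact zero_le
      calc _ ≤ ∫⁻ r in Ioi (0 : ℝ), I.indicator (fun r =>
              ENNReal.ofReal ((12 * Real.pi * κ / h) ^ 2) * ENNReal.ofReal r⁻¹) r :=
            setLIntegral_mono' measurableSet_Ioi pt
        _ ≤ ∫⁻ r, I.indicator (fun r =>
              ENNReal.ofReal ((12 * Real.pi * κ / h) ^ 2) * ENNReal.ofReal r⁻¹) r :=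
            setLIntegral_le_lintegral _ _
        _ = ENNReal.ofReal ((12 * Real.pi * κ / h) ^ 2 * (2 * (Real.pi * h / κ))) := by
            rw [lintegral_indicator measurableSet_Icc, lintegral_const_mul' _ _ ENNReal.ofReal_ne_top,
              setLIntegral_inv_Icc_exp (by positivity), ← ENNReal.ofReal_mul (by positivity)]
        _ ≤ _ := by
            rw [← ENNReal.ofReal_mul (by positivity)]
            refine ENNReal.ofReal_le_ofReal ?_
            have e1 : (12 * Real.pi * κ / h) ^ 2 * (2 * (Real.pi * h / κ))
                = 2 * Real.pi * (12 * Real.pi) ^ 2 * κ * h⁻¹ := by field_simp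
            have e2 : h⁻¹ ≤ Real.exp s * Real.exp (-(κ * |θ|)) := by
              rw [← Real.exp_add]
              refine (inv_anti₀ (Real.exp_pos _) hlow).trans (le_of_eq ?_)
              rw [← Real.exp_neg]; ring_nf
            rw [e1, mul_assoc _ (Real.exp s)]
            gcongr
    · rw [indicator_of_notMem (show θ ∉ {x : ℝ | a ≤ |x|} from hθa), mul_zero]
      refine le_of_eq ?_
      rw [setLIntegral_congr_fun (g := fun _ => 0) measurableSet_Ioi, lintegral_zero]
      intro r hr
      have : (r : ℂ) * w ∉ V := by
        intro hmem
        have := hmem.2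
        rw [← Complex.real_smul, angle_smul_left_of_pos _ _ hr, hang] at this
        exact hθa this
      simp only [indicator_of_notMem this, mul_zero]
  have hsm : MeasurableSet {x : ℝ | a ≤ |x|} := measurableSet_le measurable_const (by fun_prop)
  calc _ ≤ ∫⁻ θ in Ioo (-Real.pi) Real.pi,
        ENNReal.ofReal (2 * Real.pi * (12 * Real.pi) ^ 2 * κ * Real.exp s) *
        {x : ℝ | a ≤ |x|}.indicator (fun x => ENNReal.ofReal (Real.exp (-(κ * |x|)))) θ :=
        setLIntegral_mono' measurableSet_Ioo inner_le
    _ ≤ ∫⁻ θ : ℝ,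
        ENNReal.ofReal (2 * Real.pi * (12 * Real.pi) ^ 2 * κ * Real.exp s) *
        {x : ℝ | a ≤ |x|}.indicator (fun x => ENNReal.ofReal (Real.exp (-(κ * |x|)))) θ :=
        setLIntegral_le_lintegral _ _
    _ ≤ ENNReal.ofReal (2 * Real.pi * (12 * Real.pi) ^ 2 * κ * Real.exp s) *
        ENNReal.ofReal (2 * Real.exp (-(κ * a)) / κ) := by
        rw [lintegral_const_mul' _ _ ENNReal.ofReal_ne_top, lintegral_indicator hsm]
        gcongr
        exact setLIntegral_exp_neg_abs_le hκ ha
    _ = _ := by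
        rw [← ENNReal.ofReal_mul (by positivity), sub_eq_add_neg, Real.exp_add]
        congr 1; field_simp; norm_num

open MeasureTheory Set InnerProductGeometry in
/-- The modulus of the curves that join the two boundary components of an annulus of the shape
of two half-collars glued with the twist given by `q` and `q'`. -/
theorem curveModulus_connectingCurves_le {κ s s' a : ℝ} {q q' : ℂ} {Ω E E' : Set ℂ}
    (hκ : 1 ≤ Real.pi * κ) (hs : κ * Real.pi ≤ s) (hs' : κ * Real.pi ≤ s')
    (hq : ‖q‖ = 1) (hq' : ‖q'‖ = 1) (ha : 0 ≤ a) (hqq' : 2 * a ≤ angle q q')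
    (hΩ : ∀ z ∈ Ω, |κ * Real.log ‖z‖ + Real.pi / 2| ≤ Real.pi * collarHeight κ s s' q q' z)
    (hE : ∀ z ∈ E, z ≠ 0 ∧
      Real.exp (κ * angle z q - s) / 2 ≤ -(κ * Real.log ‖z‖) - Real.pi / 2)
    (hE' : ∀ z ∈ E', z ≠ 0 ∧
      Real.exp (κ * angle z q' - s') / 2 ≤ κ * Real.log ‖z‖ + Real.pi / 2) :
    curveModulus Ω (connectingCurves Ω E E') ≤
      ENNReal.ofReal (8 * Real.pi * (12 * Real.pi) ^ 2 * Real.exp (max s s' - κ * a)) := by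
  have hπ := Real.pi_pos
  have hκ0 : 0 < κ := by by_contra h; nlinarith
  refine (curveModulus_le (ρ := fun z => (collarDensity κ s s' q q' z).toNNReal)
    measurable_collarDensity.real_toNNReal ?_).trans ?_
  · rintro c ⟨hcont, hlip, h0, h1, -⟩
    exact one_le_rhoLength_collarDensity hκ hs hs' hcont hlip (hE _ h0).1 (hE' _ h1).1
      (hE _ h0).2 (hE' _ h1).2
  · have hsub : Ω ⊆ {z | |κ * Real.log ‖z‖ + Real.pi / 2| ≤ Real.pi * collarHeight κ s s' q q' z
        ∧ a ≤ angle z q} ∪ {z | |κ * Real.log ‖z‖ + Real.pi / 2|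
          ≤ Real.pi * collarHeight κ s' s q' q z ∧ a ≤ angle z q'} := by
      intro z hz
      have htri := angle_le_angle_add_angle q z q'
      rw [angle_comm q z] at htri
      -- As `q` and `q'` are at least `2a` apart, `z` is at angle at least `a` from one of them.
      rcases le_or_gt a (angle z q) with h | h
      · exact Or.inl ⟨hΩ z hz, h⟩
      · exact Or.inr ⟨by rw [collarHeight_swap]; exact hΩ z hz, by linarith⟩
    refine (lintegral_mono_set hsub).trans ((lintegral_union_le _ _ _).trans ?_)
    have A1 := setLIntegral_collarDensity_sq_sector_le (κ := κ) (s := s) (s' := s') (q' := q')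
      hκ0 hq ha
    have A2 := setLIntegral_collarDensity_sq_sector_le (κ := κ) (s := s') (s' := s) (q' := q)
      hκ0 hq' ha
    have hswap : ∀ z, collarDensity κ s' s q' q z = collarDensity κ s s' q q' z := fun z => by
      unfold collarDensity; rw [collarHeight_swap]
    simp_rw [hswap] at A2
    refine (add_le_add A1 A2).trans ?_
    rw [← ENNReal.ofReal_add (by positivity) (by positivity)]
    refine ENNReal.ofReal_le_ofReal ?_
    have m1 : Real.exp (s - κ * a) ≤ Real.exp (max s s' - κ * a) :=
      Real.exp_le_exp.2 (by linarith [le_max_left s s'])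
    have m2 : Real.exp (s' - κ * a) ≤ Real.exp (max s s' - κ * a) :=
      Real.exp_le_exp.2 (by linarith [le_max_right s s'])
    calc _ ≤ 4 * Real.pi * (12 * Real.pi) ^ 2 * Real.exp (max s s' - κ * a)
          + 4 * Real.pi * (12 * Real.pi) ^ 2 * Real.exp (max s s' - κ * a) := by gcongr
      _ = _ := by ring

/-! ### Geodesics as zero sets of quadratic forms -/

/-- The quadratic form `A |z|² + B Re z + C`. Its zero set in `ℍ` is a geodesic if `4AC < B²`. -/
def quadForm (A B C : ℝ) (z : ℍ) : ℝ := A * (z.re ^ 2 + z.im ^ 2) + B * z.re + C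

theorem quadForm_proportional {A B C A' B' C' : ℝ} (hdisc : 4 * A * C < B ^ 2)
    (h : ∀ z, quadForm A B C z = 0 → quadForm A' B' C' z = 0) :
    ∃ l, A' = l * A ∧ B' = l * B ∧ C' = l * C := by
  by_cases hA : A = 0
  · subst hA
    have hB : B ≠ 0 := by rintro rfl; simp at hdisc
    have h1 := h ⟨⟨-C / B, 1⟩, one_pos⟩ (by
      change 0 * ((-C / B) ^ 2 + 1 ^ 2) + B * (-C / B) + C = 0; field_simp; ring)
    have h2 := h ⟨⟨-C / B, 2⟩, two_pos⟩ (by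
      change 0 * ((-C / B) ^ 2 + 2 ^ 2) + B * (-C / B) + C = 0; field_simp; ring)
    change A' * ((-C / B) ^ 2 + 1 ^ 2) + B' * (-C / B) + C' = 0 at h1
    change A' * ((-C / B) ^ 2 + 2 ^ 2) + B' * (-C / B) + C' = 0 at h2
    have hA' : A' = 0 := by linarith
    subst hA'
    refine ⟨B' / B, by ring, by field_simp, ?_⟩
    have : C' = -(B' * (-C / B)) := by linarith
    rw [this]; ring
  · set r := Real.sqrt ((B ^ 2 - 4 * A * C) / (4 * A ^ 2)) with hr
    have hr0 : 0 < r := Real.sqrt_pos.2 (div_pos (by linarith) (by positivity))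
    have hr2 : r ^ 2 = (B ^ 2 - 4 * A * C) / (4 * A ^ 2) :=
      Real.sq_sqrt (div_pos (by linarith) (by positivity)).le
    have e : A * r ^ 2 = B ^ 2 / (4 * A) - C := by rw [hr2]; field_simp
    set x := -B / (2 * A) with hx
    have ex : A * x ^ 2 + B * x = -(B ^ 2 / (4 * A)) := by rw [hx]; field_simp; ring
    have eB : B = -(2 * A * x) := by rw [hx]; field_simp
    have h1 := h ⟨⟨x, r⟩, hr0⟩ (by
      change A * (x ^ 2 + r ^ 2) + B * x + C = 0; linarith)
    -- The top of the semicircle and one more point of it, taken from the 3-4-5 triangle, already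
    -- determine the form up to a factor.
    have h2 := h ⟨⟨x + r * (3 / 5), r * (4 / 5)⟩, by positivity⟩ (by
      change A * ((x + r * (3 / 5)) ^ 2 + (r * (4 / 5)) ^ 2) + B * (x + r * (3 / 5)) + C = 0
      have : A * ((x + r * (3 / 5)) ^ 2 + (r * (4 / 5)) ^ 2) + B * (x + r * (3 / 5)) + C
        = (A * x ^ 2 + B * x) + A * r ^ 2 + C + (3 / 5) * r * (B + 2 * A * x) := by ring
      rw [this, e, ex, eB]; ring)
    change A' * (x ^ 2 + r ^ 2) + B' * x + C' = 0 at h1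
    change A' * ((x + r * (3 / 5)) ^ 2 + (r * (4 / 5)) ^ 2) + B' * (x + r * (3 / 5)) + C' = 0 at h2
    have h3 : r * (B' + 2 * A' * x) = 0 := by linear_combination (5 / 3) * (h2 - h1)
    have h4 : B' = -(2 * A' * x) := by
      have := (mul_eq_zero.1 h3).resolve_left hr0.ne'; linarith
    refine ⟨A' / A, by field_simp, by rw [h4, eB]; field_simp, ?_⟩
    have eC : C = A * x ^ 2 - A * r ^ 2 := by
      rw [e, show A * x ^ 2 = B ^ 2 / (4 * A) by rw [hx]; field_simp; ring]; ring
    have : C' = A' * x ^ 2 - A' * r ^ 2 := by rw [h4] at h1; linarith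
    rw [this, eC]; field_simp

namespace Hyp

/-- The coefficient of `|z|²` in a quadratic form that defines the geodesic of `g`. -/
def coeffA (g : GL (Fin 2) ℝ) : ℝ := -(g 1 0 * g 1 1)

/-- The coefficient of `Re z` in a quadratic form that defines the geodesic of `g`. -/
def coeffB (g : GL (Fin 2) ℝ) : ℝ := g 0 0 * g 1 1 + g 0 1 * g 1 0

/-- The constant term of a quadratic form that defines the geodesic of `g`. -/
def coeffC (g : GL (Fin 2) ℝ) : ℝ := -(g 0 0 * g 0 1)

/-- The quadratic form that vanishes on the geodesic of `g` and is positive on its side. -/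
def form (g : GL (Fin 2) ℝ) (z : ℍ) : ℝ := quadForm (coeffA g) (coeffB g) (coeffC g) z

theorem det_entries_ne_zero (g : GL (Fin 2) ℝ) : g 0 0 * g 1 1 - g 0 1 * g 1 0 ≠ 0 := by
  have := g.det.ne_zero
  rwa [Matrix.GeneralLinearGroup.val_det_apply, Matrix.det_fin_two] at this

/-- The discriminant `B² - 4AC` is the square of the determinant of `g`. -/
theorem coeff_disc (g : GL (Fin 2) ℝ) : 4 * coeffA g * coeffC g < coeffB g ^ 2 := by
  have := sq_pos_of_ne_zero (det_entries_ne_zero g)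
  unfold coeffA coeffB coeffC
  nlinarith

theorem num_inv (g : GL (Fin 2) ℝ) (z : ℂ) : UpperHalfPlane.num g⁻¹ z
    = (g 1 1 * z - g 0 1) / ((g 0 0 * g 1 1 - g 0 1 * g 1 0 : ℝ) : ℂ) := by
  unfold UpperHalfPlane.num
  simp only [Matrix.coe_units_inv, Matrix.inv_def, Matrix.adjugate_fin_two, Matrix.det_fin_two,
    Ring.inverse_eq_inv']
  simp
  ring

theorem denom_inv (g : GL (Fin 2) ℝ) (z : ℂ) : UpperHalfPlane.denom g⁻¹ z
    = (-(g 1 0 * z) + g 0 0) / ((g 0 0 * g 1 1 - g 0 1 * g 1 0 : ℝ) : ℂ) := by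
  unfold UpperHalfPlane.denom
  simp only [Matrix.coe_units_inv, Matrix.inv_def, Matrix.adjugate_fin_two, Matrix.det_fin_two,
    Ring.inverse_eq_inv']
  simp
  ring

theorem num_div_denom_inv (g : GL (Fin 2) ℝ) (z : ℂ) :
    UpperHalfPlane.num g⁻¹ z / UpperHalfPlane.denom g⁻¹ z
      = (g 1 1 * z - g 0 1) / (-(g 1 0 * z) + g 0 0) := by
  rw [num_inv, denom_inv, div_div_div_cancel_right₀]
  exact_mod_cast det_entries_ne_zero g

theorem denom_entries_ne_zero (g : GL (Fin 2) ℝ) (z : ℍ) :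
    (-(g 1 0 * (z : ℂ)) + g 0 0 : ℂ) ≠ 0 := by
  have := UpperHalfPlane.denom_ne_zero g⁻¹ z
  rw [denom_inv] at this
  exact (div_ne_zero_iff.1 this).1

theorem re_inv_smul (g : GL (Fin 2) ℝ) (z : ℍ) : (g⁻¹ • z).re
    = form g z / Complex.normSq (-(g 1 0 * (z : ℂ)) + g 0 0) := by
  rw [UpperHalfPlane.re_smul, num_div_denom_inv, Complex.div_re, ← add_div]
  congr 1
  simp only [form, quadForm, coeffA, coeffB, coeffC]
  simp
  ring

theorem norm_inv_smul_eq_one_iff (g : GL (Fin 2) ℝ) (z : ℍ) :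
    ‖((g⁻¹ • z : ℍ) : ℂ)‖ = 1 ↔ quadForm (g 1 1 ^ 2 - g 1 0 ^ 2)
      (2 * (g 0 0 * g 1 0 - g 0 1 * g 1 1)) (g 0 1 ^ 2 - g 0 0 ^ 2) z = 0 := by
  rw [UpperHalfPlane.coe_smul, UpperHalfPlane.norm_σ, num_div_denom_inv, norm_div,
    div_eq_one_iff_eq (norm_ne_zero_iff.2 (denom_entries_ne_zero g z)),
    ← sq_eq_sq₀ (norm_nonneg _) (norm_nonneg _), Complex.sq_norm, Complex.sq_norm, ← sub_eq_zero]
  have : Complex.normSq (g 1 1 * (z : ℂ) - g 0 1) - Complex.normSq (-(g 1 0 * (z : ℂ)) + g 0 0)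
      = quadForm (g 1 1 ^ 2 - g 1 0 ^ 2)
      (2 * (g 0 0 * g 1 0 - g 0 1 * g 1 1)) (g 0 1 ^ 2 - g 0 0 ^ 2) z := by
    simp [Complex.normSq_apply, quadForm]
    ring
  rw [this]

theorem mem_line_iff {g : GL (Fin 2) ℝ} {z : ℍ} : z ∈ line g ↔ form g z = 0 := by
  have h := Complex.normSq_pos.2 (denom_entries_ne_zero g z)
  change (g⁻¹ • z).re = 0 ↔ _
  rw [re_inv_smul, div_eq_zero_iff, or_iff_left h.ne']

theorem mem_side_iff {g : GL (Fin 2) ℝ} {z : ℍ} : z ∈ side g ↔ 0 < form g z := by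
  have h := Complex.normSq_pos.2 (denom_entries_ne_zero g z)
  change 0 < (g⁻¹ • z).re ↔ _
  rw [re_inv_smul, div_pos_iff_of_pos_right h]

theorem mem_closedSide_iff {g : GL (Fin 2) ℝ} {z : ℍ} : z ∈ closedSide g ↔ 0 ≤ form g z := by
  have h := Complex.normSq_pos.2 (denom_entries_ne_zero g z)
  change 0 ≤ (g⁻¹ • z).re ↔ _
  rw [re_inv_smul, le_div_iff₀ h, zero_mul]

theorem coeff_proportional {g : GL (Fin 2) ℝ} {A B C : ℝ}
    (h : ∀ z ∈ line g, quadForm A B C z = 0) :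
    ∃ l, A = l * coeffA g ∧ B = l * coeffB g ∧ C = l * coeffC g :=
  quadForm_proportional (coeff_disc g) fun z hz => h z (mem_line_iff.2 hz)

/-- Orthogonality is the vanishing of the polarized discriminant. This is a polynomial identity for
the model pair of `k`, and it passes to `g` and `h` because forms with the same geodesic are
proportional. -/
theorem Orthogonal.coeff {g h : GL (Fin 2) ℝ} (ho : Orthogonal g h) :
    coeffB g * coeffB h = 2 * (coeffA g * coeffC h + coeffC g * coeffA h) := by
  obtain ⟨k, hg, hh⟩ := ho
  obtain ⟨l, hA, hB, hC⟩ := coeff_proportional (g := g) (A := coeffA k) (B := coeffB k)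
    (C := coeffC k) fun z hz => mem_line_iff.1 (hg ▸ hz)
  obtain ⟨m, hA', hB', hC'⟩ := coeff_proportional (g := h) fun z hz =>
    (norm_inv_smul_eq_one_iff k z).1 (show z ∈ {z : ℍ | ‖((k⁻¹ • z : ℍ) : ℂ)‖ = 1} from hh ▸ hz)
  have hd := det_entries_ne_zero k
  have hl : l ≠ 0 := by
    rintro rfl
    have := coeff_disc k
    rw [hA, hB, hC] at this; simp at this
  have hm : m ≠ 0 := by
    rintro rfl
    -- The squared determinant is a quarter of the discriminant of the form of the image of the unit
    -- circle.
    have e : (k 0 0 * k 1 1 - k 0 1 * k 1 0) ^ 2 = 0 := by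
      simp only [zero_mul] at hA' hB' hC'
      linear_combination (k 0 0 * k 1 0 - k 0 1 * k 1 1) / 2 * hB' - (k 0 1 ^ 2 - k 0 0 ^ 2) * hA'
    exact hd (pow_eq_zero_iff two_ne_zero |>.1 e)
  have key : coeffB k * (2 * (k 0 0 * k 1 0 - k 0 1 * k 1 1))
      = 2 * (coeffA k * (k 0 1 ^ 2 - k 0 0 ^ 2) + coeffC k * (k 1 1 ^ 2 - k 1 0 ^ 2)) := by
    unfold coeffA coeffB coeffC; ring
  rw [hA, hB, hC, hA', hB', hC'] at key
  refine mul_left_cancel₀ (mul_ne_zero hl hm) ?_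
  linear_combination key

theorem Orthogonal.nonempty_inter {g h : GL (Fin 2) ℝ} (ho : Orthogonal g h) :
    (line g ∩ line h).Nonempty := by
  obtain ⟨k, hg, hh⟩ := ho
  refine ⟨k • UpperHalfPlane.I, ?_, ?_⟩
  · rw [hg]; simp [line]
  · rw [hh]; simp

theorem coeff_of_mem_ends {g : GL (Fin 2) ℝ} {e : OnePoint ℝ} (he : e ∈ ends g) :
    (e = OnePoint.infty ∧ coeffA g = 0) ∨
      ∃ x : ℝ, e = (x : OnePoint ℝ) ∧ coeffA g * x ^ 2 + coeffB g * x + coeffC g = 0 := by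
  rcases he with rfl | rfl
  · rw [OnePoint.smul_some_eq_ite]
    by_cases h : g 1 1 = 0
    · left; simp [h, coeffA]
    · right
      refine ⟨g 0 1 / g 1 1, by simp [h], ?_⟩
      unfold coeffA coeffB coeffC; field_simp; ring
  · rw [OnePoint.smul_infty_eq_ite]
    by_cases h : g 1 0 = 0
    · left; simp [h, coeffA]
    · right
      refine ⟨g 0 0 / g 1 0, by simp [h], ?_⟩
      unfold coeffA coeffB coeffC; field_simp; ring

/-- The endpoints of a geodesic in the half-plane `σ Re z > 0` lie in its closure. -/
theorem nonneg_of_root_of_line_subset {g : GL (Fin 2) ℝ} {σ e : ℝ} (hσ : |σ| = 1)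
    (h : ∀ z ∈ line g, 0 < σ * z.re) (he : coeffA g * e ^ 2 + coeffB g * e + coeffC g = 0) :
    0 ≤ σ * e := by
  have hd := coeff_disc g
  set A := coeffA g with hA
  set B := coeffB g with hB
  set C := coeffC g with hC
  have h' : ∀ x y : ℝ, 0 < y → A * (x ^ 2 + y ^ 2) + B * x + C = 0 → 0 < σ * x := fun x y hy hQ =>
    h ⟨⟨x, y⟩, hy⟩ (mem_line_iff.2 hQ)
  by_cases hA0 : A = 0
  · rw [hA0] at he
    exact (h' e 1 one_pos (by rw [hA0]; linarith)).le
  · by_contra! hneg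
    set D := -B / A - 2 * e with hD
    have hB' : B = -A * (D + 2 * e) := by rw [hD]; field_simp; ring
    have hC' : C = A * e * (e + D) := by rw [hB'] at he; linarith
    have hD0 : D ≠ 0 := by
      intro h0
      rw [hC', hB', h0] at hd
      nlinarith
    have he0 : 0 < |e| := abs_pos.2 (by rintro rfl; simp at hneg)
    have hDp : 0 < |D| := abs_pos.2 hD0
    -- The endpoints are `e` and `e + D`. The point of the semicircle above `e + τ * D` is so close
    -- to `e` that its real part is still not on the required side.
    set τ := |e| / (|e| + |D|) with hτ
    have hτ0 : 0 < τ := by positivity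
    have hτ1 : τ < 1 := by rw [hτ, div_lt_one (by positivity)]; linarith
    have hs : Real.sqrt (τ * (1 - τ)) ^ 2 = τ * (1 - τ) :=
      Real.sq_sqrt (mul_pos hτ0 (by linarith)).le
    have := h' (e + τ * D) (Real.sqrt (τ * (1 - τ)) * |D|)
      (mul_pos (Real.sqrt_pos.2 (mul_pos hτ0 (by linarith))) hDp) (by
        rw [mul_pow, hs, sq_abs, hB', hC']; ring)
    have e1 : σ * e = -|e| := by
      have := abs_of_neg hneg
      rw [abs_mul, hσ, one_mul] at this
      linarith
    have e2 : σ * (τ * D) ≤ τ * |D| := by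
      refine (le_abs_self _).trans (le_of_eq ?_)
      rw [abs_mul, abs_mul, hσ, abs_of_pos hτ0, one_mul]
    have e3 : τ * |D| ≤ |e| := by
      rw [hτ, div_mul_eq_mul_div, div_le_iff₀ (by positivity)]
      nlinarith
    nlinarith

/-- With `B = 0` the geodesic is a semicircle centred at `0`, of squared radius `-C/A`, and the
reflection is inversion in it. -/
theorem coe_reflection_smul {g : GL (Fin 2) ℝ} (hB : coeffB g = 0) (z : ℍ) :
    ((reflection g • z : ℍ) : ℂ)
      = ((-coeffC g / coeffA g : ℝ) : ℂ) / (starRingEnd ℂ) (z : ℂ) := by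
  have hd := det_entries_ne_zero g
  have hdet : (reflection g).det.val = -1 := by
    simp [reflection]
  have hval : (reflection g).val = (g 0 0 * g 1 1 - g 0 1 * g 1 0)⁻¹ •
      !![-coeffB g, -2 * coeffC g; 2 * coeffA g, coeffB g] := by
    unfold reflection coeffA coeffB coeffC
    simp only [Matrix.GeneralLinearGroup.coe_mul, UpperHalfPlane.val_J, Matrix.coe_units_inv,
      Matrix.inv_def, Matrix.adjugate_fin_two, Matrix.det_fin_two, Ring.inverse_eq_inv']
    rw [Matrix.eta_fin_two g.val]
    ext i j
    fin_cases i <;> fin_cases j <;> simp <;> ring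
  have hA : coeffA g ≠ 0 := by
    intro h0
    have := coeff_disc g
    rw [h0, hB] at this; simp at this
  have hz : (starRingEnd ℂ) (z : ℂ) ≠ 0 := by simpa using UpperHalfPlane.ne_zero z
  rw [UpperHalfPlane.coe_smul, UpperHalfPlane.σ, if_neg (by rw [hdet]; norm_num)]
  simp only [UpperHalfPlane.num, UpperHalfPlane.denom, hval, hB]
  have hA' : (coeffA g : ℂ) ≠ 0 := by exact_mod_cast hA
  have hd' : (g 0 0 * g 1 1 - g 0 1 * g 1 0 : ℂ) ≠ 0 := by exact_mod_cast hd
  simp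
  field_simp

end Hyp

/-! ### The half-collar with `α` on the imaginary axis -/

theorem Hyp.form_eq (g : GL (Fin 2) ℝ) (z : ℍ) :
    form g z = coeffA g * (z.re ^ 2 + z.im ^ 2) + coeffB g * z.re + coeffC g := rfl

/-- A geodesic orthogonal to the imaginary axis at `p` is the semicircle `‖z‖ = p.im`. -/
theorem Hyp.Orthogonal.coeff_of_imaginaryAxis {a g : GL (Fin 2) ℝ} {p : ℍ} (ho : Orthogonal a g)
    (ha : line a = {z | z.re = 0}) (hp : p ∈ line a ∩ line g) :
    p.re = 0 ∧ coeffB g = 0 ∧ coeffC g = -(coeffA g * p.im ^ 2) ∧ coeffA g ≠ 0 := by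
  obtain ⟨l, hA, hB, hC⟩ := coeff_proportional (g := a) (A := 0) (B := 1) (C := 0) fun z hz => by
    rw [ha] at hz; simpa [quadForm] using hz
  have hl : l ≠ 0 := by rintro rfl; simp at hB
  have hB0 : coeffB a ≠ 0 := by intro h; simp [h] at hB
  have hA0 : coeffA a = 0 := (mul_eq_zero.1 hA.symm).resolve_left hl
  have hC0 : coeffC a = 0 := (mul_eq_zero.1 hC.symm).resolve_left hl
  have hort := ho.coeff
  rw [hA0, hC0] at hort
  have hBg : coeffB g = 0 := (mul_eq_zero.1 (by linarith)).resolve_left hB0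
  have hre : p.re = 0 := by have := hp.1; rwa [ha] at this
  have hpg := mem_line_iff.1 hp.2
  rw [form_eq, hre, hBg] at hpg
  refine ⟨hre, hBg, by linarith, ?_⟩
  intro h
  have := coeff_disc g
  rw [h, hBg] at this; simp at this

namespace NonstandardHalfCollar

variable {H : NonstandardHalfCollar} {σ : ℝ}

theorem form_γ (hα : line H.α = {z | z.re = 0}) (z : ℍ) :
    form H.γ z = coeffA H.γ * (z.re ^ 2 + z.im ^ 2 - H.x.im ^ 2) := by
  obtain ⟨-, h1, h2, -⟩ := H.α_orth_γ.coeff_of_imaginaryAxis hα H.x_mem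
  rw [form_eq, h1, h2]; ring

theorem form_ζ (hα : line H.α = {z | z.re = 0}) (z : ℍ) :
    form H.ζ z = coeffA H.ζ * (z.re ^ 2 + z.im ^ 2 - H.y.im ^ 2) := by
  obtain ⟨-, h1, h2, -⟩ := H.α_orth_ζ.coeff_of_imaginaryAxis hα H.y_mem
  rw [form_eq, h1, h2]; ring

theorem x_re (hα : line H.α = {z | z.re = 0}) : H.x.re = 0 :=
  (H.α_orth_γ.coeff_of_imaginaryAxis hα H.x_mem).1

theorem y_re (hα : line H.α = {z | z.re = 0}) : H.y.re = 0 :=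
  (H.α_orth_ζ.coeff_of_imaginaryAxis hα H.y_mem).1

theorem form_ζ_x_pos (hα : line H.α = {z | z.re = 0}) :
    0 < coeffA H.ζ * (H.x.im ^ 2 - H.y.im ^ 2) := by
  have := mem_side_iff.1 (H.γ_ζ H.x_mem.2)
  rw [form_ζ hα, x_re hα] at this
  linarith

theorem form_γ_y_pos (hα : line H.α = {z | z.re = 0}) :
    0 < coeffA H.γ * (H.y.im ^ 2 - H.x.im ^ 2) := by
  have := mem_side_iff.1 (H.ζ_γ H.y_mem.2)
  rw [form_γ hα, y_re hα] at this
  linarith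

theorem dist_x_y (hα : line H.α = {z | z.re = 0}) :
    dist H.x H.y = |Real.log H.x.im - Real.log H.y.im| := by
  rw [UpperHalfPlane.dist_of_re_eq (by rw [x_re hα, y_re hα]), Real.dist_eq]

theorem cosh_half_lengthAlpha (hα : line H.α = {z | z.re = 0}) :
    Real.cosh (H.lengthAlpha / 2) = (H.x.im ^ 2 + H.y.im ^ 2) / (2 * H.x.im * H.y.im) := by
  have : H.lengthAlpha / 2 = dist H.x H.y := by unfold lengthAlpha; ring
  rw [this, UpperHalfPlane.cosh_dist', x_re hα, y_re hα]; ring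

/-- Between the two seams, the logarithm of the modulus differs from that at `ζ` by at most half
the length of `α`. -/
theorem abs_log_norm_sub_le (hα : line H.α = {z | z.re = 0}) {z : ℍ}
    (hγ : z ∈ closedSide H.γ) (hζ : z ∈ closedSide H.ζ) :
    |Real.log ‖(z : ℂ)‖ - Real.log H.y.im| ≤ H.lengthAlpha / 2 := by
  have hl : H.lengthAlpha / 2 = |Real.log H.x.im - Real.log H.y.im| := by
    rw [← dist_x_y hα]; unfold lengthAlpha; ring
  rw [hl]
  have h1 := mem_closedSide_iff.1 hγ
  have h2 := mem_closedSide_iff.1 hζ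
  rw [form_γ hα] at h1
  rw [form_ζ hα] at h2
  have h3 := form_ζ_x_pos hα
  have h4 := form_γ_y_pos hα
  have hn : z.re ^ 2 + z.im ^ 2 = ‖(z : ℂ)‖ ^ 2 := by
    rw [Complex.sq_norm, Complex.normSq_apply]; simp; ring
  rw [hn] at h1 h2
  have hx := H.x.im_pos
  have hy := H.y.im_pos
  have hz : 0 < ‖(z : ℂ)‖ := norm_pos_iff.2 z.ne_zero
  set X := H.x.im
  set Y := H.y.im
  set N := ‖(z : ℂ)‖
  -- Either foot may be the higher one; the order fixes the signs of the leading coefficients of `γ`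
  -- and `ζ`.
  rcases lt_or_ge Y X with hlt | hge
  · have hXY : 0 < X ^ 2 - Y ^ 2 := by nlinarith
    have hA : 0 < coeffA H.ζ := by
      by_contra! h; nlinarith
    have hA' : coeffA H.γ < 0 := by
      by_contra! h; nlinarith
    have hN1 : Y ≤ N := by
      have : 0 ≤ N ^ 2 - Y ^ 2 := by by_contra! h; nlinarith
      exact (sq_le_sq₀ hy.le hz.le).1 (by linarith)
    have hN2 : N ≤ X := by
      have : N ^ 2 - X ^ 2 ≤ 0 := by by_contra! h; nlinarith
      exact (sq_le_sq₀ hz.le hx.le).1 (by linarith)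
    have := Real.log_le_log hy hN1
    have := Real.log_le_log hz hN2
    rw [abs_of_nonneg (by linarith), abs_of_nonneg (by linarith)]; linarith
  · have hXY : X ^ 2 - Y ^ 2 ≤ 0 := by nlinarith
    have hA : coeffA H.ζ < 0 := by
      by_contra! h; nlinarith
    have hA' : 0 < coeffA H.γ := by
      by_contra! h; nlinarith
    have hN1 : N ≤ Y := by
      have : N ^ 2 - Y ^ 2 ≤ 0 := by by_contra! h; nlinarith
      exact (sq_le_sq₀ hz.le hy.le).1 (by linarith)
    have hN2 : X ≤ N := by
      have : 0 ≤ N ^ 2 - X ^ 2 := by by_contra! h; nlinarith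
      exact (sq_le_sq₀ hx.le hz.le).1 (by linarith)
    have := Real.log_le_log hz hN1
    have := Real.log_le_log hx hN2
    rw [abs_of_nonpos (by linarith), abs_of_nonpos (by linarith)]; linarith

/-- Being orthogonal to the semicircle `ζ` of radius `H.y.im` forces the ratio `C/A` to be `H.y.im ^
2`; the sign of `A` comes from `α` lying on the positive side. -/
theorem coeff_β (hα : line H.α = {z | z.re = 0}) :
    coeffC H.β = coeffA H.β * H.y.im ^ 2 ∧ 0 < coeffA H.β := by
  obtain ⟨-, h1, h2, h3⟩ := H.α_orth_ζ.coeff_of_imaginaryAxis hα H.y_mem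
  have hort := H.β_orth_ζ.coeff
  rw [h1, h2] at hort
  have hC : coeffC H.β = coeffA H.β * H.y.im ^ 2 :=
    mul_right_cancel₀ h3 (by linarith)
  have hpos := mem_side_iff.1 (H.α_β H.y_mem.1)
  rw [form_eq, y_re hα, hC] at hpos
  have := H.y.im_pos
  refine ⟨hC, ?_⟩
  by_contra! h
  nlinarith [sq_nonneg H.y.im]

theorem sq_coeffA_lt_sq_of_orthogonal (hα : line H.α = {z | z.re = 0}) {α₁ : GL (Fin 2) ℝ}
    (ho : Orthogonal α₁ H.γ) : coeffC α₁ = coeffA α₁ * H.x.im ^ 2 ∧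
      4 * coeffA α₁ ^ 2 * H.x.im ^ 2 < coeffB α₁ ^ 2 := by
  obtain ⟨-, h1, h2, h3⟩ := H.α_orth_γ.coeff_of_imaginaryAxis hα H.x_mem
  have hort := ho.coeff
  rw [h1, h2] at hort
  have hC : coeffC α₁ = coeffA α₁ * H.x.im ^ 2 :=
    mul_right_cancel₀ h3 (by linarith)
  have := coeff_disc α₁
  rw [hC] at this
  exact ⟨hC, by linarith⟩

/-- A common endpoint of `γ` and `δ` is a real point on the side of the half-collar. -/
theorem common_end (hα : line H.α = {z | z.re = 0}) (hσ : |σ| = 1)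
    (hside : side H.α = {z | 0 < σ * z.re}) {e : OnePoint ℝ} (hγ : e ∈ ends H.γ)
    (hδ : e ∈ ends H.δ) :
    e = ((σ * H.x.im : ℝ) : OnePoint ℝ) ∧
      coeffA H.δ * (σ * H.x.im) ^ 2 + coeffB H.δ * (σ * H.x.im) + coeffC H.δ = 0 := by
  obtain ⟨-, h1, h2, h3⟩ := H.α_orth_γ.coeff_of_imaginaryAxis hα H.x_mem
  obtain ⟨u, rfl, hu⟩ := (coeff_of_mem_ends hγ).resolve_left fun h => h3 h.2
  have hu2 : u ^ 2 = H.x.im ^ 2 := by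
    rw [h1, h2] at hu
    exact mul_left_cancel₀ h3 (by linarith)
  obtain ⟨v, huv, hv⟩ := (coeff_of_mem_ends hδ).resolve_left fun h => OnePoint.coe_ne_infty _ h.1
  obtain rfl : u = v := OnePoint.coe_injective huv
  have hnn : 0 ≤ σ * u := nonneg_of_root_of_line_subset hσ (fun z hz => by
    have := H.δ_α hz
    rwa [hside] at this) hv
  have hσ2 : σ ^ 2 = 1 := by rw [← sq_abs, hσ, one_pow]
  have hsu : σ * u = H.x.im := by
    refine (sq_eq_sq₀ hnn H.x.im_pos.le).1 ?_
    rw [mul_pow, hσ2, one_mul, hu2]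
  have : u = σ * H.x.im := by rw [← hsu]; linear_combination (-u) * hσ2
  rw [← this]
  exact ⟨rfl, hv⟩

/-- If `α₁` is a closed geodesic then it is not a puncture. -/
theorem not_isCusped_of_orthogonal (hα : line H.α = {z | z.re = 0}) (hσ : |σ| = 1)
    (hside : side H.α = {z | 0 < σ * z.re}) {α₁ : GL (Fin 2) ℝ}
    (hγ : Orthogonal α₁ H.γ) (hδ : Orthogonal α₁ H.δ) : ¬ H.IsCusped := by
  rintro ⟨e, heγ, heδ⟩
  obtain ⟨-, he⟩ := common_end hα hσ hside heγ heδ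
  obtain ⟨hC, hdisc⟩ := sq_coeffA_lt_sq_of_orthogonal hα hγ
  have hort := hδ.coeff
  rw [hC] at hort
  have hσ2 : σ ^ 2 = 1 := by rw [← sq_abs, hσ, one_pow]
  -- Orthogonality of `α₁` and `δ` factors once the common endpoint is known to be a root of the
  -- form of `δ`. The second factor is nonzero because the discriminant of `α₁` is positive. The
  -- remaining case `coeffB H.δ = 0` would put `H.x` on `δ`.
  have hprod : coeffB H.δ * (coeffB α₁ + 2 * coeffA α₁ * (σ * H.x.im)) = 0 := by
    linear_combination hort + 2 * coeffA α₁ * he - 2 * coeffA α₁ * coeffA H.δ * H.x.im ^ 2 * hσ2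
  have hne : coeffB α₁ + 2 * coeffA α₁ * (σ * H.x.im) ≠ 0 := by
    intro h0
    have : coeffB α₁ ^ 2 = 4 * coeffA α₁ ^ 2 * H.x.im ^ 2 := by
      rw [eq_neg_of_add_eq_zero_left h0]
      linear_combination 4 * coeffA α₁ ^ 2 * H.x.im ^ 2 * hσ2
    linarith
  have hB := (mul_eq_zero.1 hprod).resolve_right hne
  have hx := mem_side_iff.1 (H.γ_δ H.x_mem.2)
  rw [form_eq, x_re hα, hB] at hx
  rw [hB, mul_pow, hσ2] at he
  linarith

/-- The centre of the Euclidean circle that carries `β`. -/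
theorem coeffB_β (hα : line H.α = {z | z.re = 0}) (hσ : |σ| = 1)
    (hside : side H.α = {z | 0 < σ * z.re}) :
    coeffA H.β * ((H.x.im ^ 2 + H.y.im ^ 2) / H.x.im) ≤ -(σ * coeffB H.β) ∧
      (H.IsCusped →
        -(σ * coeffB H.β) = coeffA H.β * ((H.x.im ^ 2 + H.y.im ^ 2) / H.x.im)) := by
  obtain ⟨hC, hA⟩ := coeff_β hα
  have hx := H.x.im_pos
  have hσ2 : σ ^ 2 = 1 := by rw [← sq_abs, hσ, one_pow]
  rcases H.β_through_b with ⟨α₁, hoγ, hoδ, p, ⟨hpγ, hp1⟩, hpβ⟩ | ⟨e, ⟨heγ, heδ⟩, heβ⟩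
  · refine ⟨?_, fun h => absurd h (not_isCusped_of_orthogonal hα hσ hside hoγ hoδ)⟩
    obtain ⟨hC1, hdisc⟩ := sq_coeffA_lt_sq_of_orthogonal hα hoγ
    obtain ⟨d, hd1, hdδ⟩ := hoδ.nonempty_inter
    have hdre : 0 < σ * d.re := by
      have := H.δ_α hdδ; rwa [hside] at this
    have hd := mem_line_iff.1 hd1
    have hp := mem_line_iff.1 hp1
    have hpn := mem_line_iff.1 hpγ
    have hpb := mem_line_iff.1 hpβ
    rw [form_γ hα] at hpn
    obtain ⟨-, -, -, h3⟩ := H.α_orth_γ.coeff_of_imaginaryAxis hα H.x_mem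
    have hpn' : p.re ^ 2 + p.im ^ 2 = H.x.im ^ 2 := by
      have := (mul_eq_zero.1 hpn).resolve_left h3; linarith
    rw [form_eq, hC1] at hd hp
    rw [form_eq, hC] at hpb
    rw [hpn'] at hp hpb
    have hB1 : coeffB α₁ ≠ 0 := by
      intro h0; rw [h0] at hdisc
      nlinarith [sq_nonneg (coeffA α₁ * H.x.im)]
    -- Eliminating the coefficients of `α₁` shows that its feet `p` on `γ` and `d` on `δ` lie on the
    -- same side of `α`, which is the side of `δ`.
    have hrel : p.re * (d.re ^ 2 + d.im ^ 2 + H.x.im ^ 2) = 2 * H.x.im ^ 2 * d.re := by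
      refine mul_left_cancel₀ hB1 ?_
      linear_combination (d.re ^ 2 + d.im ^ 2 + H.x.im ^ 2) * hp - 2 * H.x.im ^ 2 * hd
    have hpre : 0 < σ * p.re := by
      have h1 : 0 < d.re ^ 2 + d.im ^ 2 + H.x.im ^ 2 := by positivity
      have h2 : 0 < (σ * p.re) * (d.re ^ 2 + d.im ^ 2 + H.x.im ^ 2) := by
        have : (σ * p.re) * (d.re ^ 2 + d.im ^ 2 + H.x.im ^ 2) = 2 * H.x.im ^ 2 * (σ * d.re) := by
          linear_combination σ * hrel
        rw [this]; positivity
      exact (pos_iff_pos_of_mul_pos h2).2 h1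
    have hplt : σ * p.re ≤ H.x.im := by
      refine (sq_le_sq₀ hpre.le hx.le).1 ?_
      rw [mul_pow, hσ2]
      nlinarith [sq_nonneg p.im]
    -- With this product fixed, the inequality follows from `σ * p.re ≤ H.x.im`; a puncture is the
    -- limiting case of equality.
    have hprod : -(σ * coeffB H.β) * (σ * p.re) = coeffA H.β * (H.x.im ^ 2 + H.y.im ^ 2) := by
      linear_combination -hpb - coeffB H.β * p.re * hσ2
    have hpos : 0 < -(σ * coeffB H.β) := by
      have : 0 < -(σ * coeffB H.β) * (σ * p.re) := by
        rw [hprod]; have := H.y.im_pos; positivity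
      exact (pos_iff_pos_of_mul_pos this).2 hpre
    rw [← mul_div_assoc, div_le_iff₀ hx, ← hprod]
    gcongr
  · obtain ⟨rfl, -⟩ := common_end hα hσ hside heγ heδ
    obtain ⟨v, huv, hv⟩ := (coeff_of_mem_ends heβ).resolve_left
      fun h => OnePoint.coe_ne_infty _ h.1
    have hv' : v = σ * H.x.im := (OnePoint.coe_injective huv).symm
    rw [hv', hC] at hv
    have key : -(σ * coeffB H.β) = coeffA H.β * ((H.x.im ^ 2 + H.y.im ^ 2) / H.x.im) := by
      field_simp
      linear_combination -hv + coeffA H.β * H.x.im ^ 2 * hσ2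
    exact ⟨key.ge, fun _ => key⟩

/-- The half-length `s` of the projection of `β` to `α`, which is `collarWidth (ℓ(η))`. -/
theorem form_β (hα : line H.α = {z | z.re = 0}) (hσ : |σ| = 1)
    (hside : side H.α = {z | 0 < σ * z.re}) :
    (∀ z, form H.β z = coeffA H.β * (z.re ^ 2 + z.im ^ 2 + H.y.im ^ 2
        - 2 * H.y.im * Real.cosh (collarWidth H.lengthEta) * (σ * z.re))) ∧
      H.lengthAlpha / 2 ≤ collarWidth H.lengthEta ∧
      (H.IsCusped → collarWidth H.lengthEta = H.lengthAlpha / 2) := by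
  obtain ⟨hC, hA⟩ := coeff_β hα
  obtain ⟨hle, hcusp⟩ := coeffB_β hα hσ hside
  have hx := H.x.im_pos
  have hy := H.y.im_pos
  have hσ2 : σ ^ 2 = 1 := by rw [← sq_abs, hσ, one_pow]
  have hdisc := coeff_disc H.β
  rw [hC] at hdisc
  -- This is `cosh s`: the centre of `β` divided by `H.y.im`.
  set k := -(σ * coeffB H.β) / (2 * coeffA H.β * H.y.im) with hk
  have hkB : -(σ * coeffB H.β) = 2 * coeffA H.β * H.y.im * k := by rw [hk]; field_simp
  have hB : coeffB H.β = -(2 * coeffA H.β * H.y.im * k * σ) := by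
    linear_combination (-σ) * hkB - coeffB H.β * hσ2
  have hkpos : 0 < k := by
    have : 0 < coeffA H.β * ((H.x.im ^ 2 + H.y.im ^ 2) / H.x.im) := by positivity
    rw [hk]; exact div_pos (this.trans_le hle) (by positivity)
  have hk1 : 1 < k := by
    rw [hB] at hdisc
    have : (2 * coeffA H.β * H.y.im) ^ 2 * 1 < (2 * coeffA H.β * H.y.im) ^ 2 * k ^ 2 := by
      have : (-(2 * coeffA H.β * H.y.im * k * σ)) ^ 2 = (2 * coeffA H.β * H.y.im) ^ 2 * k ^ 2 := by
        linear_combination (2 * coeffA H.β * H.y.im * k) ^ 2 * hσ2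
      nlinarith
    have : 1 < k ^ 2 := lt_of_mul_lt_mul_left this (by positivity)
    nlinarith
  set s := Real.arcosh k with hs
  have hcosh : Real.cosh s = k := Real.cosh_arcosh hk1.le
  have hs0 : 0 < s := Real.arcosh_pos hk1
  -- The foot `c` has `σ * c.re = Y / cosh s` and `c.im = Y * tanh s`, where `Y = H.y.im`. Hence
  -- `cosh ℓ(η) = coth s`, that is `sinh ℓ(η) = 1 / sinh s`, and the function `r` inverts this
  -- relation.
  have hη : collarWidth H.lengthEta = s := by
    have hc := mem_line_iff.1 H.c_mem.1
    have hc2 := mem_line_iff.1 H.c_mem.2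
    rw [form_ζ hα] at hc2
    obtain ⟨-, -, -, h3⟩ := H.α_orth_ζ.coeff_of_imaginaryAxis hα H.y_mem
    have hcn : H.c.re ^ 2 + H.c.im ^ 2 = H.y.im ^ 2 := by
      have := (mul_eq_zero.1 hc2).resolve_left h3; linarith
    rw [form_eq, hcn, hC, hB] at hc
    have hkc : k * (σ * H.c.re) = H.y.im := by
      refine mul_left_cancel₀ (show 2 * coeffA H.β * H.y.im ≠ 0 by positivity) ?_
      linear_combination -hc
    have hci := H.c.im_pos
    have hsinh : 0 < Real.sinh s := Real.sinh_pos_iff.2 hs0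
    have hcs : Real.cosh s ^ 2 - Real.sinh s ^ 2 = 1 := Real.cosh_sq_sub_sinh_sq s
    have him : k * H.c.im = H.y.im * Real.sinh s := by
      refine (sq_eq_sq₀ (by positivity) (by positivity)).1 ?_
      rw [hcosh] at hcs
      linear_combination k ^ 2 * hcn - (k * (σ * H.c.re) + H.y.im) * hkc
        + k ^ 2 * H.c.re ^ 2 * hσ2 - H.y.im ^ 2 * (-1) * hcs
    have hcd : Real.cosh H.lengthEta = H.y.im / H.c.im := by
      unfold lengthEta
      rw [UpperHalfPlane.cosh_dist', y_re hα]
      have : (0 - H.c.re) ^ 2 + H.y.im ^ 2 + H.c.im ^ 2 = 2 * H.y.im ^ 2 := by linarith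
      rw [this]; field_simp
    have hcd' : Real.cosh H.lengthEta = k / Real.sinh s := by
      rw [hcd, div_eq_div_iff hci.ne' hsinh.ne']; linarith
    have hη0 : 0 ≤ H.lengthEta := dist_nonneg
    have hsd : Real.sinh H.lengthEta = 1 / Real.sinh s := by
      refine (sq_eq_sq₀ (Real.sinh_nonneg_iff.2 hη0) (by positivity)).1 ?_
      rw [Real.sinh_sq, hcd', ← hcosh]
      field_simp
      linarith
    unfold collarWidth
    rw [hsd, one_div_one_div, Real.arsinh_sinh]
  have hl0 : 0 ≤ H.lengthAlpha / 2 := by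
    unfold lengthAlpha; have := @dist_nonneg _ _ H.x H.y; linarith
  have hratio : Real.cosh (H.lengthAlpha / 2)
      = coeffA H.β * ((H.x.im ^ 2 + H.y.im ^ 2) / H.x.im) / (2 * coeffA H.β * H.y.im) := by
    rw [cosh_half_lengthAlpha hα]; field_simp
  rw [hη]
  refine ⟨fun z => ?_, ?_, fun h => ?_⟩
  · rw [form_eq, hcosh, hC, hB]; ring
  · have : Real.cosh (H.lengthAlpha / 2) ≤ Real.cosh s := by
      rw [hratio, hcosh, hk]; gcongr
    rwa [Real.cosh_le_cosh, abs_of_nonneg hl0, abs_of_pos hs0] at this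
  · have : Real.cosh (H.lengthAlpha / 2) = Real.cosh s := by
      rw [hratio, hcosh, hk, hcusp h]
    exact (Real.cosh_injOn hl0 hs0.le this).symm

end NonstandardHalfCollar

/-! ### The half-collar in the round annulus -/

theorem angle_exp_mul_I_of_abs_le {x y : ℝ} (h : |x - y| ≤ Real.pi) :
    InnerProductGeometry.angle (Complex.exp (x * Complex.I)) (Complex.exp (y * Complex.I))
      = |x - y| := by
  have aux : ∀ x y : ℝ, -Real.pi < x - y → x - y ≤ Real.pi →
      InnerProductGeometry.angle (Complex.exp (x * Complex.I)) (Complex.exp (y * Complex.I))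
        = |x - y| := by
    intro x y h1 h2
    rw [Complex.angle_exp_exp, (toIocMod_eq_self Real.two_pi_pos).2 ⟨h1, by linarith⟩]
  obtain ⟨h1, h2⟩ := abs_le.1 h
  -- The principal argument lies in `(-π, π]`, so a difference of exactly `-π` is handled by
  -- exchanging the two points.
  rcases h1.lt_or_eq with h1 | h1
  · exact aux x y h1 h2
  · rw [InnerProductGeometry.angle_comm, abs_sub_comm]
    exact aux y x (by linarith [Real.pi_pos]) (by linarith)

theorem log_norm_cylinderMap (l : ℝ) (w : ℍ) :
    Real.log ‖cylinderMap l w‖ = -(2 * Real.pi / l * Complex.arg w) := by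
  unfold cylinderMap
  rw [Complex.norm_exp, Real.log_exp]
  have : 2 * Real.pi * Complex.I / l * Complex.log (w : ℂ)
      = ((2 * Real.pi / l : ℝ) : ℂ) * (Complex.log w * Complex.I) := by push_cast; ring
  rw [this, Complex.re_ofReal_mul, Complex.mul_I_re, Complex.log_im]; ring

theorem angle_cylinderMap (l u : ℝ) (w : ℍ) :
    InnerProductGeometry.angle (cylinderMap l w)
        (Complex.exp ((2 * Real.pi / l * u : ℝ) * Complex.I))
      = InnerProductGeometry.angle
        (Complex.exp ((2 * Real.pi / l * Real.log ‖(w : ℂ)‖ : ℝ) * Complex.I))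
        (Complex.exp ((2 * Real.pi / l * u : ℝ) * Complex.I)) := by
  have : cylinderMap l w = Real.exp (-(2 * Real.pi / l * Complex.arg w))
      • Complex.exp ((2 * Real.pi / l * Real.log ‖(w : ℂ)‖ : ℝ) * Complex.I) := by
    unfold cylinderMap
    rw [Complex.real_smul, Complex.ofReal_exp, ← Complex.exp_add]
    congr 1
    conv_lhs => rw [Complex.log]
    push_cast
    linear_combination (2 * Real.pi / l * Complex.arg w) * Complex.I_sq
  rw [this, InnerProductGeometry.angle_smul_left_of_pos _ _ (Real.exp_pos _)]

namespace NonstandardHalfCollar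

variable {H : NonstandardHalfCollar} {σ : ℝ}

theorem norm_sq_coe (z : ℍ) : z.re ^ 2 + z.im ^ 2 = ‖(z : ℂ)‖ ^ 2 := by
  rw [Complex.sq_norm, Complex.normSq_apply]; simp; ring

/-- Writing `‖z‖² + Y² = 2 * Y * ‖z‖ * cosh (log ‖z‖ - log Y)` with `Y = H.y.im` turns `β` into
`cosh s * sin u = cosh v`. -/
theorem form_β_polar (hα : line H.α = {z | z.re = 0}) (hσ : |σ| = 1)
    (hside : side H.α = {z | 0 < σ * z.re}) (z : ℍ) :
    form H.β z = coeffA H.β * (2 * H.y.im * ‖(z : ℂ)‖) *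
      (Real.cosh |Real.log ‖(z : ℂ)‖ - Real.log H.y.im|
        - Real.cosh (collarWidth H.lengthEta) * (σ * (z.re / ‖(z : ℂ)‖))) := by
  have hz : 0 < ‖(z : ℂ)‖ := norm_pos_iff.2 z.ne_zero
  have hy := H.y.im_pos
  rw [(form_β hα hσ hside).1, norm_sq_coe, Real.cosh_abs, Real.cosh_eq (_ - _), neg_sub,
    Real.exp_sub, Real.exp_sub, Real.exp_log hz, Real.exp_log hy]
  field_simp

/-- Reflection in `ζ` preserves the argument and the distance to `ζ` along the seam. -/
theorem exists_of_mem_double (hα : line H.α = {z | z.re = 0}) {S : Set ℍ} {w : ℍ}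
    (hw : w ∈ H.double S) : ∃ z ∈ S,
      |Real.log ‖(w : ℂ)‖ - Real.log H.y.im| = |Real.log ‖(z : ℂ)‖ - Real.log H.y.im| ∧
      w.re / ‖(w : ℂ)‖ = z.re / ‖(z : ℂ)‖ := by
  rcases hw with hw | ⟨z, hz, rfl⟩
  · exact ⟨w, hw, rfl, rfl⟩
  · refine ⟨z, hz, ?_⟩
    obtain ⟨-, h1, h2, h3⟩ := H.α_orth_ζ.coeff_of_imaginaryAxis hα H.y_mem
    have hn : 0 < ‖(z : ℂ)‖ := norm_pos_iff.2 z.ne_zero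
    have hy := H.y.im_pos
    have hcoe := coe_reflection_smul h1 z
    have hY : -coeffC H.ζ / coeffA H.ζ = H.y.im ^ 2 := by rw [h2]; field_simp
    rw [hY] at hcoe
    have hnorm : ‖((reflection H.ζ • z : ℍ) : ℂ)‖ = H.y.im ^ 2 / ‖(z : ℂ)‖ := by
      rw [hcoe, norm_div, RCLike.norm_conj, Complex.norm_real, Real.norm_of_nonneg (by positivity)]
    have hre : (reflection H.ζ • z).re = H.y.im ^ 2 * z.re / ‖(z : ℂ)‖ ^ 2 := by
      rw [← UpperHalfPlane.coe_re, hcoe, Complex.div_re, Complex.normSq_conj, Complex.sq_norm,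
        Complex.ofReal_re, Complex.ofReal_im]
      simp
    dsimp only
    rw [hnorm, hre]
    constructor
    · rw [Real.log_div (by positivity) hn.ne', Real.log_pow, ← abs_neg]
      congr 1; push_cast; ring
    · field_simp

theorem nonneg_of_mem_closedSide (hα : line H.α = {z | z.re = 0})
    (hside : side H.α = {z | 0 < σ * z.re}) {z : ℍ} (hz : z ∈ closedSide H.α) : 0 ≤ σ * z.re := by
  rcases (mem_closedSide_iff.1 hz).eq_or_lt with h | h
  · have : z ∈ line H.α := mem_line_iff.2 h.symm
    rw [hα] at this
    rw [show z.re = 0 from this, mul_zero]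
  · have : z ∈ side H.α := mem_side_iff.2 h
    rw [hside] at this
    exact le_of_lt this

theorem double_quadrilateral_bounds (hα : line H.α = {z | z.re = 0}) (hσ : |σ| = 1)
    (hside : side H.α = {z | 0 < σ * z.re}) {w : ℍ} (hw : w ∈ H.double H.quadrilateral) :
    |Real.log ‖(w : ℂ)‖ - Real.log H.y.im| ≤ H.lengthAlpha / 2 ∧
      0 ≤ σ * (w.re / ‖(w : ℂ)‖) ∧
      Real.cosh (collarWidth H.lengthEta) * (σ * (w.re / ‖(w : ℂ)‖))
        ≤ Real.cosh |Real.log ‖(w : ℂ)‖ - Real.log H.y.im| := by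
  obtain ⟨z, ⟨⟨⟨h1, h2⟩, h3⟩, h4⟩, e1, e2⟩ := exists_of_mem_double hα hw
  have hz : 0 < ‖(z : ℂ)‖ := norm_pos_iff.2 z.ne_zero
  rw [e1, e2]
  refine ⟨abs_log_norm_sub_le hα h2 h3, ?_, ?_⟩
  · rw [← mul_div_assoc]
    exact div_nonneg (nonneg_of_mem_closedSide hα hside h1) hz.le
  · have hf := mem_side_iff.1 h4
    rw [form_β_polar hα hσ hside] at hf
    have hA := (coeff_β hα).2
    have hy := H.y.im_pos
    have := (pos_iff_pos_of_mul_pos hf).1 (by positivity)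
    linarith

theorem double_perpendicular_bounds (hα : line H.α = {z | z.re = 0}) (hσ : |σ| = 1)
    (hside : side H.α = {z | 0 < σ * z.re}) {w : ℍ} (hw : w ∈ H.double H.perpendicular) :
    |Real.log ‖(w : ℂ)‖ - Real.log H.y.im| ≤ H.lengthAlpha / 2 ∧
      Real.cosh (collarWidth H.lengthEta) * (σ * (w.re / ‖(w : ℂ)‖))
        = Real.cosh |Real.log ‖(w : ℂ)‖ - Real.log H.y.im| := by
  obtain ⟨z, ⟨⟨h1, h2⟩, h3⟩, e1, e2⟩ := exists_of_mem_double hα hw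
  have hz : 0 < ‖(z : ℂ)‖ := norm_pos_iff.2 z.ne_zero
  rw [e1, e2]
  refine ⟨abs_log_norm_sub_le hα h2 h3, ?_⟩
  have hf := mem_line_iff.1 h1
  rw [form_β_polar hα hσ hside] at hf
  have hA := (coeff_β hα).2
  have hy := H.y.im_pos
  have := (mul_eq_zero.1 hf).resolve_left (by positivity)
  linarith

/-- The direction, in the round annulus, of the foot on `α` of the seam on `ζ`. -/
noncomputable def direction (H : NonstandardHalfCollar) : ℂ :=
  Complex.exp ((2 * Real.pi / H.lengthAlpha * Real.log H.y.im : ℝ) * Complex.I)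

/-- A distance of at most `ℓ/2` along `α` corresponds to an angle of at most `π`, so there is no
wrapping around the annulus. -/
theorem angle_direction (hl : 0 < H.lengthAlpha) {w : ℍ}
    (hw : |Real.log ‖(w : ℂ)‖ - Real.log H.y.im| ≤ H.lengthAlpha / 2) :
    H.lengthAlpha / (2 * Real.pi) *
        InnerProductGeometry.angle (cylinderMap H.lengthAlpha w) H.direction
      = |Real.log ‖(w : ℂ)‖ - Real.log H.y.im| := by
  have hπ := Real.pi_pos
  have e : |2 * Real.pi / H.lengthAlpha * Real.log ‖(w : ℂ)‖
        - 2 * Real.pi / H.lengthAlpha * Real.log H.y.im|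
      = 2 * Real.pi / H.lengthAlpha * |Real.log ‖(w : ℂ)‖ - Real.log H.y.im| := by
    rw [← mul_sub, abs_mul, abs_of_pos (by positivity)]
  unfold direction
  rw [angle_cylinderMap, angle_exp_mul_I_of_abs_le, e]
  · field_simp
  · rw [e, div_mul_eq_mul_div, div_le_iff₀ hl]
    nlinarith

theorem sin_side (hσ : |σ| = 1) (w : ℍ) :
    Real.sin (σ * (Real.pi / 2 - Complex.arg w)) = σ * (w.re / ‖(w : ℂ)‖) := by
  have hc : Real.cos (Complex.arg w) = w.re / ‖(w : ℂ)‖ := by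
    rw [Complex.cos_arg w.ne_zero]; simp
  rcases (abs_eq (zero_le_one' ℝ)).1 hσ with rfl | rfl
  · rw [one_mul, one_mul, Real.sin_pi_div_two_sub, hc]
  · rw [neg_one_mul, Real.sin_neg, Real.sin_pi_div_two_sub, hc]; ring

theorem abs_side_lt (hσ : |σ| = 1) (w : ℍ) :
    |σ * (Real.pi / 2 - Complex.arg w)| < Real.pi / 2 := by
  rw [abs_mul, hσ, one_mul, abs_lt]
  have h1 : 0 < Complex.arg w := by
    have h := Complex.arg_nonneg_iff.2 (show 0 ≤ (w : ℂ).im from w.im_pos.le)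
    refine h.lt_of_ne fun h0 => ?_
    exact w.im_pos.ne' (Complex.arg_eq_zero_iff.1 h0.symm).2
  have h2 : Complex.arg w < Real.pi := Complex.arg_lt_pi_iff.2 (Or.inr w.im_pos.ne')
  constructor <;> linarith

theorem exp_abs_sub_bounds {v s : ℝ} (hs : 0 ≤ s) :
    Real.exp (|v| - s) / 2 ≤ Real.cosh |v| / Real.cosh s ∧
      Real.cosh |v| / Real.cosh s ≤ 2 * Real.exp (|v| - s) := by
  have h1 : Real.exp |v| / 2 ≤ Real.cosh |v| := by
    rw [Real.cosh_eq]; linarith [Real.exp_pos (-|v|)]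
  have h2 : Real.cosh |v| ≤ Real.exp |v| := by
    rw [Real.cosh_eq]
    have : Real.exp (-|v|) ≤ Real.exp |v| := Real.exp_le_exp.2 (by linarith [abs_nonneg v])
    linarith
  have h3 : Real.exp s / 2 ≤ Real.cosh s := by
    rw [Real.cosh_eq]; linarith [Real.exp_pos (-s)]
  have h4 : Real.cosh s ≤ Real.exp s := by
    rw [Real.cosh_eq]
    have : Real.exp (-s) ≤ Real.exp s := Real.exp_le_exp.2 (by linarith)
    linarith
  have hc := Real.cosh_pos s
  rw [Real.exp_sub]
  constructor
  · calc Real.exp |v| / Real.exp s / 2 = (Real.exp |v| / 2) / Real.exp s := by ring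
      _ ≤ Real.cosh |v| / Real.cosh s := by gcongr
  · calc Real.cosh |v| / Real.cosh s ≤ Real.exp |v| / (Real.exp s / 2) := by gcongr
      _ = _ := by ring

/-- The height of the half-collar above each of its directions, from above. -/
theorem region_bound (hα : line H.α = {z | z.re = 0}) (hσ : |σ| = 1)
    (hside : side H.α = {z | 0 < σ * z.re}) (hl : 0 < H.lengthAlpha) {z : ℂ} (hz : z ∈ H.region) :
    |H.lengthAlpha / (2 * Real.pi) * Real.log ‖z‖ + Real.pi / 2| ≤ Real.pi *
      Real.exp (H.lengthAlpha / (2 * Real.pi) * InnerProductGeometry.angle z H.direction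
        - collarWidth H.lengthEta) := by
  obtain ⟨w, hw, rfl⟩ := hz
  have hπ := Real.pi_pos
  obtain ⟨h1, h2, h3⟩ := double_quadrilateral_bounds hα hσ hside hw
  have hs : 0 ≤ collarWidth H.lengthEta := by
    have := (form_β hα hσ hside).2.1; linarith
  rw [angle_direction hl h1, log_norm_cylinderMap]
  set u := σ * (Real.pi / 2 - Complex.arg w) with hu
  have hsin : Real.sin u = σ * (w.re / ‖(w : ℂ)‖) := sin_side hσ w
  obtain ⟨hu1, hu2⟩ := abs_lt.1 (abs_side_lt hσ w)
  rw [← hu] at hu1 hu2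
  rw [← hsin] at h2 h3
  have hu0 : 0 ≤ u := by
    by_contra! h
    exact absurd (Real.sin_neg_of_neg_of_neg_pi_lt h (by linarith)) (not_lt.2 h2)
  have habs : |H.lengthAlpha / (2 * Real.pi) * -(2 * Real.pi / H.lengthAlpha * Complex.arg w)
      + Real.pi / 2| = u := by
    have : H.lengthAlpha / (2 * Real.pi) * -(2 * Real.pi / H.lengthAlpha * Complex.arg w)
      + Real.pi / 2 = Real.pi / 2 - Complex.arg w := by field_simp; ring
    rw [this, ← abs_of_nonneg hu0, hu, abs_mul, hσ, one_mul]
  rw [habs]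
  have hms := Real.mul_le_sin hu0 hu2.le
  have hle : Real.sin u ≤ 2 * Real.exp (|Real.log ‖(w : ℂ)‖ - Real.log H.y.im|
      - collarWidth H.lengthEta) := by
    refine le_trans ?_ (exp_abs_sub_bounds hs).2
    rw [le_div_iff₀ (Real.cosh_pos _)]; linarith
  calc u = Real.pi / 2 * (2 / Real.pi * u) := by field_simp
    _ ≤ Real.pi / 2 * (2 * Real.exp (|Real.log ‖(w : ℂ)‖ - Real.log H.y.im|
      - collarWidth H.lengthEta)) := by exact mul_le_mul_of_nonneg_left (hms.trans hle) (by positivity)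
    _ = _ := by ring

/-- The height of the half-collar above each of its directions, from below. -/
theorem loop_bound (hα : line H.α = {z | z.re = 0}) (hσ : |σ| = 1)
    (hside : side H.α = {z | 0 < σ * z.re}) (hl : 0 < H.lengthAlpha) {z : ℂ} (hz : z ∈ H.loop) :
    z ≠ 0 ∧ Real.exp (H.lengthAlpha / (2 * Real.pi) * InnerProductGeometry.angle z H.direction
        - collarWidth H.lengthEta) / 2
      ≤ σ * (H.lengthAlpha / (2 * Real.pi) * Real.log ‖z‖ + Real.pi / 2) := by
  have hπ := Real.pi_pos
  have hs : 0 ≤ collarWidth H.lengthEta := by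
    have := (form_β hα hσ hside).2.1; linarith
  set κ := H.lengthAlpha / (2 * Real.pi) with hκ
  -- The loop is a closure, so the bound must hold on a closed set. The inner radius of the round
  -- annulus keeps this set away from `0`, where `log` and the angle are not continuous.
  set r := Real.exp (-(2 * Real.pi / H.lengthAlpha * Real.pi)) with hr
  have hr0 : 0 < r := Real.exp_pos _
  set T := {z ∈ {z : ℂ | r ≤ ‖z‖} | Real.exp (κ * InnerProductGeometry.angle z H.direction
        - collarWidth H.lengthEta) / 2 ≤ σ * (κ * Real.log ‖z‖ + Real.pi / 2)} with hT
  have hne : ∀ z ∈ {z : ℂ | r ≤ ‖z‖}, z ≠ 0 := by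
    rintro z hz rfl
    simp only [Set.mem_ofPred_eq, norm_zero] at hz; linarith
  have hTclosed : IsClosed T := by
    refine IsClosed.isClosed_le (isClosed_le continuous_const continuous_norm) ?_ ?_
    · have hang : ContinuousOn (fun z : ℂ => InnerProductGeometry.angle z H.direction)
          {z : ℂ | r ≤ ‖z‖} := fun z hz => by
        have := (InnerProductGeometry.continuousAt_angle (x := (z, H.direction)) (hne z hz)
          (Complex.exp_ne_zero _))
        exact (this.comp (f := fun z : ℂ => (z, H.direction))
          (by fun_prop)).continuousWithinAt
      fun_prop
    · have hlog : ContinuousOn (fun z : ℂ => Real.log ‖z‖) {z : ℂ | r ≤ ‖z‖} :=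
        continuous_norm.continuousOn.log fun z hz => norm_ne_zero_iff.2 (hne z hz)
      fun_prop
  have hsub : cylinderMap H.lengthAlpha '' H.double H.perpendicular ⊆ T := by
    rintro _ ⟨w, hw, rfl⟩
    obtain ⟨h1, h3⟩ := double_perpendicular_bounds hα hσ hside hw
    have hlog := log_norm_cylinderMap H.lengthAlpha w
    have hpos : 0 < ‖cylinderMap H.lengthAlpha w‖ := norm_pos_iff.2 (Complex.exp_ne_zero _)
    refine ⟨?_, ?_⟩
    · change r ≤ _
      rw [hr, ← Real.le_log_iff_exp_le hpos, hlog, neg_le_neg_iff]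
      have := Complex.arg_le_pi w
      gcongr
    · rw [hκ, angle_direction hl h1, hlog]
      set u := σ * (Real.pi / 2 - Complex.arg w) with hu
      have hsin : Real.sin u = σ * (w.re / ‖(w : ℂ)‖) := sin_side hσ w
      rw [← hsin] at h3
      have he : σ * (H.lengthAlpha / (2 * Real.pi) *
          -(2 * Real.pi / H.lengthAlpha * Complex.arg w) + Real.pi / 2) = u := by
        rw [hu]; field_simp; ring
      rw [he]
      have hsu : Real.sin u = Real.cosh |Real.log ‖(w : ℂ)‖ - Real.log H.y.im|
          / Real.cosh (collarWidth H.lengthEta) := by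
        rw [← h3]; field_simp [(Real.cosh_pos (collarWidth H.lengthEta)).ne']
      have hb := (exp_abs_sub_bounds (v := Real.log ‖(w : ℂ)‖ - Real.log H.y.im) hs).1
      rw [← hsu] at hb
      have hs0 : 0 < Real.sin u := lt_of_lt_of_le (by positivity) hb
      have hu0 : 0 ≤ u := by
        by_contra! h
        have := (abs_lt.1 (abs_side_lt hσ w)).1
        exact absurd (Real.sin_neg_of_neg_of_neg_pi_lt h (by linarith)) (not_lt.2 hs0.le)
      exact hb.trans (Real.sin_le hu0)
  have hzT := closure_minimal hsub hTclosed hz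
  exact ⟨hne z hzT.1, hzT.2⟩

theorem norm_direction : ‖H.direction‖ = 1 := by
  unfold direction; exact Complex.norm_exp_ofReal_mul_I _

theorem log_x_sub_log_y (hα : line H.α = {z | z.re = 0}) :
    Real.log H.x.im - Real.log H.y.im = H.lengthAlpha / 2 ∨
      Real.log H.x.im - Real.log H.y.im = -(H.lengthAlpha / 2) := by
  have hl : |Real.log H.x.im - Real.log H.y.im| = H.lengthAlpha / 2 := by
    rw [← dist_x_y hα]; unfold lengthAlpha; ring
  rcases abs_choice (Real.log H.x.im - Real.log H.y.im) with h | h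
  · left; linarith
  · right; linarith

end NonstandardHalfCollar

/-! ### Gluing and conclusion -/

-- On each half-collar the foot of `η` is antipodal on `α` to the foot of `γ`, so the twist between
-- the feet of `γ` and `γ'` is also the twist between those of `η` and `η'`, modulo `ℓ(α)`.
open NonstandardHalfCollar in
theorem GluedWithTwist.angle_direction {H H' : NonstandardHalfCollar} {t : ℝ}
    (hG : GluedWithTwist H H' t) (hl : 0 < H.lengthAlpha) (ht : |t| ≤ 1 / 2) :
    InnerProductGeometry.angle H.direction H'.direction = 2 * Real.pi * |t| := by
  have hπ := Real.pi_pos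
  obtain ⟨k, hk⟩ := hG.twist
  have hlog : Real.log H'.x.im = Real.log H.x.im + (t + k) * H.lengthAlpha := by
    rw [hk, Real.log_mul H.x.im_pos.ne' (Real.exp_pos _).ne', Real.log_exp]
  obtain ⟨m, hm⟩ : ∃ m : ℤ,
      Real.log H'.y.im = Real.log H.y.im + (t + m) * H.lengthAlpha := by
    rcases log_x_sub_log_y hG.left.1 with h | h <;> rcases log_x_sub_log_y hG.right.1 with h' | h' <;>
      rw [hG.length_eq] at h'
    · exact ⟨k, by linarith⟩
    · exact ⟨k + 1, by push_cast; linarith⟩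
    · exact ⟨k - 1, by push_cast; linarith⟩
    · exact ⟨k, by linarith⟩
  have hdir : H'.direction = Complex.exp
      ((2 * Real.pi / H.lengthAlpha * Real.log H.y.im + 2 * Real.pi * t : ℝ) * Complex.I) := by
    unfold direction
    rw [hG.length_eq, hm, Complex.exp_eq_exp_iff_exists_int]
    refine ⟨m, ?_⟩
    have : (H.lengthAlpha : ℂ) ≠ 0 := by exact_mod_cast hl.ne'
    push_cast
    field_simp
    ring
  have e : |2 * Real.pi / H.lengthAlpha * Real.log H.y.im
      - (2 * Real.pi / H.lengthAlpha * Real.log H.y.im + 2 * Real.pi * t)|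
      = 2 * Real.pi * |t| := by
    rw [sub_add_cancel_left, abs_neg, abs_mul, abs_of_pos (by positivity)]
  rw [hdir, direction, angle_exp_mul_I_of_abs_le, e]
  rw [e]
  nlinarith

open NonstandardHalfCollar in
theorem le_gluedExtremalDistance {H H' : NonstandardHalfCollar} {t : ℝ}
    (hG : GluedWithTwist H H' t) (hl : 2 ≤ H.lengthAlpha) (ht : |t| ≤ 1 / 2) :
    ENNReal.ofReal (1 / (8 * Real.pi * (12 * Real.pi) ^ 2) /
        Real.exp (max (collarWidth H.lengthEta) (collarWidth H'.lengthEta)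
          - |t| * H.lengthAlpha / 2))
      ≤ gluedExtremalDistance H H' := by
  have hπ := Real.pi_pos
  have hl0 : 0 < H.lengthAlpha := by linarith
  have hl0' : 0 < H'.lengthAlpha := by rw [hG.length_eq]; exact hl0
  have hσ : |(-1 : ℝ)| = 1 := by simp
  have hσ' : |(1 : ℝ)| = 1 := by simp
  have hα := hG.left.1
  have hα' := hG.right.1
  have hside : side H.α = {z | 0 < (-1 : ℝ) * z.re} := by
    rw [hG.left.2]; ext z; simp
  have hside' : side H'.α = {z | 0 < (1 : ℝ) * z.re} := by
    rw [hG.right.2]; ext z; simp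
  set κ := H.lengthAlpha / (2 * Real.pi) with hκ
  have hκπ : κ * Real.pi = H.lengthAlpha / 2 := by rw [hκ]; field_simp
  have hs := (form_β hα hσ hside).2.1
  have hs' := (form_β hα' hσ' hside').2.1
  rw [hG.length_eq] at hs'
  -- The choice `a = π|t|` is half the angle between the two directions, and `κ * a = |t|ℓ/2`. The
  -- assumption `2 ≤ ℓ` is the condition `1 ≤ π * κ`.
  have hmod := curveModulus_connectingCurves_le (κ := κ) (s := collarWidth H.lengthEta)
    (s' := collarWidth H'.lengthEta) (a := Real.pi * |t|) (q := H.direction) (q' := H'.direction)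
    (Ω := H.region ∪ H'.region) (E := H.loop) (E' := H'.loop) (by rw [mul_comm, hκπ]; linarith)
    (by rw [hκπ]; exact hs) (by rw [hκπ]; exact hs') norm_direction norm_direction (by positivity)
    (by rw [hG.angle_direction hl0 ht]; linarith)
    (by
      rintro z (hz | hz)
      · refine (region_bound hα hσ hside hl0 hz).trans ?_
        unfold collarHeight
        gcongr
        exact le_add_of_nonneg_right (Real.exp_pos _).le
      · have := region_bound hα' hσ' hside' hl0' hz
        rw [hG.length_eq] at this
        refine this.trans ?_
        unfold collarHeight
        gcongr
        exact le_add_of_nonneg_left (Real.exp_pos _).le)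
    (fun z hz => by
      obtain ⟨h1, h2⟩ := loop_bound hα hσ hside hl0 hz
      exact ⟨h1, by linarith⟩)
    (fun z hz => by
      obtain ⟨h1, h2⟩ := loop_bound hα' hσ' hside' hl0' hz
      rw [hG.length_eq] at h2
      exact ⟨h1, by linarith⟩)
  have hκt : κ * (Real.pi * |t|) = |t| * H.lengthAlpha / 2 := by
    rw [← mul_assoc, hκπ]; ring
  rw [hκt] at hmod
  unfold gluedExtremalDistance extremalDistance
  refine le_trans (le_of_eq ?_) (ENNReal.inv_le_inv.2 hmod)
  rw [← ENNReal.ofReal_inv_of_pos (by positivity), div_div, one_div]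

theorem mainTheorem8 (l₀ : ℝ) (hl₀ : 2 ≤ l₀) :
    ∃ C : ℝ, 0 < C ∧
      ∀ (H H' : NonstandardHalfCollar) (t : ℝ), -(1 / 2) ≤ t → t ≤ 1 / 2 →
        GluedWithTwist H H' t → l₀ ≤ H.lengthAlpha →
          ENNReal.ofReal (C /
              max (Real.exp (collarWidth H.lengthEta - |t| * H.lengthAlpha / 2))
                (Real.exp (collarWidth H'.lengthEta - |t| * H.lengthAlpha / 2)))
            ≤ gluedExtremalDistance H H' ∧
          (H.IsCusped → H'.IsCusped →
            ENNReal.ofReal (C * Real.exp (-(1 - |t|) * H.lengthAlpha / 2))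
              ≤ gluedExtremalDistance H H') := by
  have hπ := Real.pi_pos
  refine ⟨1 / (8 * Real.pi * (12 * Real.pi) ^ 2), by positivity, ?_⟩
  intro H H' t ht1 ht2 hG hl
  have main := le_gluedExtremalDistance hG (hl₀.trans hl) (abs_le.2 ⟨ht1, ht2⟩)
  refine ⟨?_, fun hc hc' => ?_⟩
  · rwa [← Real.exp_monotone.map_max, max_sub_sub_right]
  · have hs := (NonstandardHalfCollar.form_β (σ := -1) hG.left.1 (by simp)
      (by rw [hG.left.2]; ext z; simp)).2.2 hc
    have hs' := (NonstandardHalfCollar.form_β (σ := 1) hG.right.1 (by simp)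
      (by rw [hG.right.2]; ext z; simp)).2.2 hc'
    rw [hs, hs', hG.length_eq, max_self, div_eq_mul_inv, ← Real.exp_neg] at main
    convert main using 4
    ring
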